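/- For all integers $d\ge 0$ and all reals $\varepsilon>0$, $C\ge 1$ there is a constant $K<\infty$, depending only on $d$, $\varepsilon$ and $C$, with the following property. Let $n$ be a non-negative integer and $s$ a real number with $n<s\le\min(2n,d)$ and $\varepsilon<(s-n)/2$ (in particular $1\le n<d$). Let $\nu$ be a Borel measure on $\mathbb{R}^d$ with support $F=\operatorname{supp}\nu\subset B(0,1)$ (the open unit ball) that is $s$-Ahlfors regular with constant $C$: for all $x\in F$, $$\nu(B(x,r))\le C r^s\ \text{ for all } r>0,\qquad \nu(B(x,r))\ge C^{-1}r^s\ \text{ for all } 0<r\le\operatorname{diam}F .$$ Let $M>3^n\nu(F)$ be a real number and let $L\subset\mathbb{R}^d$ be an $n$-dimensional linear subspace, identified with $\mathbb{R}^n$ by any linear isometry. Let $\pi_L:\mathbb{R}^d\to L\simeq\mathbb{R}^n$ be the orthogonal projection, let $\nu_L$ be the push-forward of $\nu$ under $\pi_L$, and let $$\mathcal{M}\nu_L(y)=\sup_{r>0}\frac{\nu_L(B(y,r))}{r^n},\qquad F_M=\{x\in F:\ \mathcal{M}\nu_L(\pi_L(x))\ge M\}.$$ Then, for $\sigma=(s-n-\varepsilon)/2$,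 $$\mathcal{H}^{n+2\varepsilon}_\infty(F_M)\le K\,M^{-1}\,\|\nu_L\|^2_{H^\sigma(\mathbb{R}^n)} .$$ Here $\mathcal{H}^t_\infty(A)=\inf\{\sum_i \operatorname{diam}(U_i)^t:\ A\subset\bigcup_{i\in\mathbb{N}} U_i\}$ is the Hausdorff content, and $\|\nu_L\|^2_{H^\sigma(\mathbb{R}^n)}=\int_{\mathbb{R}^n}|\widehat{\nu_L}(\xi)|^2(1+|\xi|^2)^\sigma\,d\xi\in[0,\infty]$ with $\widehat{\nu_L}(\xi)=\int e^{-2\pi i x\cdot\xi}\,d\nu_L(x)$; if this is infinite, the inequality is trivial. -/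

import Mathlib

open MeasureTheory
open scoped ENNReal FourierTransform

/-- The `t`-dimensional Hausdorff content of `A` (for `t > 0`): the infimum of `∑ diam(U i) ^ t`
over all countable coverings of `A`, with no restriction on the diameters. -/
noncomputable def hausdorffContent {X : Type*} [PseudoEMetricSpace X] (t : ℝ) (A : Set X) : ℝ≥0∞ :=
  ⨅ (U : ℕ → Set X) (_ : A ⊆ ⋃ i, U i), ∑' i, Metric.ediam (U i) ^ t

/-- `ν` is `s`-Ahlfors regular with constant `C`: for all `x ∈ supp ν`,
`ν(B(x,r)) ≤ C r ^ s` for all `r > 0`, and `C⁻¹ r ^ s ≤ ν(B(x,r))` for all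
`0 < r ≤ diam (supp ν)`; here `B(x,r)` is the open ball. -/
structure IsAhlforsRegular {X : Type*} [PseudoMetricSpace X] [MeasurableSpace X]
    (C s : ℝ) (ν : Measure X) : Prop where
  upper : ∀ x ∈ ν.support, ∀ r : ℝ, 0 < r → ν (Metric.ball x r) ≤ ENNReal.ofReal (C * r ^ s)
  lower : ∀ x ∈ ν.support, ∀ r : ℝ, 0 < r → ENNReal.ofReal r ≤ Metric.ediam ν.support →
    ENNReal.ofReal (C⁻¹ * r ^ s) ≤ ν (Metric.ball x r)

/-- The centered Hardy-Littlewood maximal function of a measure `μ` on `ℝⁿ`, normalized by `r ^ n`: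
`𝓜 μ (x) = sup_{r > 0} r ^ (-n) μ(B(x,r))`. If `μ` has a density `f`, this is the maximal function
of `f`, see `maximalFunction_withDensity`. -/
noncomputable def maximalFunction {n : ℕ} (μ : Measure (EuclideanSpace ℝ (Fin n)))
    (x : EuclideanSpace ℝ (Fin n)) : ℝ≥0∞ :=
  ⨆ (r : ℝ) (_ : 0 < r), (ENNReal.ofReal r ^ n)⁻¹ * μ (Metric.ball x r)

theorem maximalFunction_withDensity {n : ℕ} (f : EuclideanSpace ℝ (Fin n) → ℝ≥0∞)
    (x : EuclideanSpace ℝ (Fin n)) :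
    maximalFunction (volume.withDensity f) x =
      ⨆ (r : ℝ) (_ : 0 < r), (ENNReal.ofReal r ^ n)⁻¹ * ∫⁻ y in Metric.ball x r, f y := by
  simp only [maximalFunction, withDensity_apply f Metric.isOpen_ball.measurableSet]

/-- The Fourier transform of a finite measure on `ℝⁿ`: `μ̂(ξ) = ∫ exp(-2πi⟨x,ξ⟩) dμ(x)`. -/
noncomputable def fourierMeasure {n : ℕ} (μ : Measure (EuclideanSpace ℝ (Fin n)))
    (ξ : EuclideanSpace ℝ (Fin n)) : ℂ :=
  ∫ x, Complex.exp (((-2 * Real.pi * inner ℝ x ξ : ℝ) : ℂ) * Complex.I) ∂μ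

theorem fourierMeasure_withDensity {n : ℕ} (f : EuclideanSpace ℝ (Fin n) → NNReal)
    (hf : Measurable f) (ξ : EuclideanSpace ℝ (Fin n)) :
    fourierMeasure (volume.withDensity fun x => (f x : ℝ≥0∞)) ξ =
      𝓕 (fun x => ((f x : ℝ) : ℂ)) ξ := by
  rw [fourierMeasure, integral_withDensity_eq_integral_smul hf, Real.fourier_eq']
  congr 1 with x
  simp [NNReal.smul_def, mul_comm]

/-- The squared inhomogeneous Sobolev norm of a finite measure on `ℝⁿ`,
`‖μ‖²_{H^σ} = ∫ |μ̂(ξ)|² (1 + |ξ|²) ^ σ dξ`; it is `∞` when `μ` is not in `H^σ`. -/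
noncomputable def sobolevNormSq {n : ℕ} (σ : ℝ) (μ : Measure (EuclideanSpace ℝ (Fin n))) : ℝ≥0∞ :=
  ∫⁻ ξ, ‖fourierMeasure μ ξ‖ₑ ^ 2 * ENNReal.ofReal ((1 + ‖ξ‖ ^ 2) ^ σ)

/-- The orthogonal projection `π_L : ℝᵈ → L ≃ ℝⁿ` onto a subspace `L`, where `L` is identified
with `ℝⁿ` through the linear isometry `e`. -/
noncomputable def projTo {d n : ℕ} (L : Submodule ℝ (EuclideanSpace ℝ (Fin d)))
    (e : L ≃ₗᵢ[ℝ] EuclideanSpace ℝ (Fin n)) (x : EuclideanSpace ℝ (Fin d)) :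
    EuclideanSpace ℝ (Fin n) :=
  e (L.orthogonalProjectionOnto x)

theorem continuous_projTo {d n : ℕ} (L : Submodule ℝ (EuclideanSpace ℝ (Fin d)))
    (e : L ≃ₗᵢ[ℝ] EuclideanSpace ℝ (Fin n)) : Continuous (projTo L e) :=
  e.continuous.comp L.orthogonalProjectionOnto.continuous

/-- `ν_L`, the push-forward of `ν` under the (continuous) map `π_L`. -/
noncomputable def projMeasure {d n : ℕ} (L : Submodule ℝ (EuclideanSpace ℝ (Fin d)))
    (e : L ≃ₗᵢ[ℝ] EuclideanSpace ℝ (Fin n)) (ν : Measure (EuclideanSpace ℝ (Fin d))) :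
    Measure (EuclideanSpace ℝ (Fin n)) :=
  ν.map (projTo L e)

/-! Write `μ = ν_L`, and let `u(t)` be the average of `μ` at `y = π_L(x)` against the
`L¹`-normalized Gaussian of scale `t`. Finite mass makes `u` at most a small multiple of `M` at
scales above a multiple of `diam F`, while a maximal function of size `M` forces `u ≥ cM` at some
dyadic scale. If all order-`m` dyadic differences of `u` at the scales in between were below `b M q
^ k`, then summing back would keep `u` below `cM` (`exists_le_abs_dyadicDiff`). So some difference
is large; stopping at the first scale where `u ≥ cM` also gives `u ≤ cM` at twice the selected scale
(`exists_scale_of_le_maximalFunction`).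

On the Fourier side, the order-`m` difference is a multiplier vanishing to order `2m` at the origin
and decaying like a Gaussian, so it is dominated by the Sobolev weight
(`exists_sq_dyadicDiff_gaussian_le`). A large-sieve inequality then bounds the sum of squared
differences over finitely many points by the Sobolev norm, times the largest row sum of the Gaussian
kernel at the projected points (`sum_sq_dyadicDiff_gaussianAverage_le`). Projections of
`t`-separated points of `F` may cluster, but each carries mass about `t ^ s` nearby, so the row sum
is at most about `t ^ (n - s) * u(2t)`, hence `t ^ (n - s) * M` (`sum_exp_neg_dist_sq_le`). This one
factor `M` against the `M ^ 2` of the squared differences leaves `M⁻¹`.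

Since `2σ - s = -n - ε`, a separated set of bad points at scale `t` has at most about `M⁻¹ q ^ (-2k)
t ^ (-n-ε) ‖μ‖²` points. Covering by balls of radius `t` costs a term of order `q ^ (-2k) t ^ ε` in
the content of dimension `n + 2ε`; with `q` close enough to `1` these terms sum geometrically. -/

/-! ### Dyadic differences in the scale variable. -/

/-- Iterated dyadic differences in the scale variable: `dyadicDiff f l` is obtained from `f` by
applying successively the operators `g ↦ g(t) - 4⁻ʲ g(2t)` for `j < l`, which annihilate `t ^ (2j)`. -/
noncomputable def dyadicDiff (f : ℝ → ℝ) : ℕ → ℝ → ℝ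
  | 0 => f
  | l + 1 => fun t => dyadicDiff f l t - (4⁻¹ : ℝ) ^ l * dyadicDiff f l (2 * t)

theorem dyadicDiff_zero (f : ℝ → ℝ) (t : ℝ) : dyadicDiff f 0 t = f t := rfl

theorem dyadicDiff_succ (f : ℝ → ℝ) (l : ℕ) (t : ℝ) :
    dyadicDiff f (l + 1) t = dyadicDiff f l t - (4⁻¹ : ℝ) ^ l * dyadicDiff f l (2 * t) := rfl

theorem dyadicDiff_comp_mul (f : ℝ → ℝ) (c : ℝ) (l : ℕ) (t : ℝ) :
    dyadicDiff (fun t => f (c * t)) l t = dyadicDiff f l (c * t) := by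
  induction l generalizing t with
  | zero => rfl
  | succ l ih => rw [dyadicDiff_succ, dyadicDiff_succ, ih, ih, mul_left_comm]

theorem abs_dyadicDiff_le {f : ℝ → ℝ} {B t₀ : ℝ} (ht₀ : 0 ≤ t₀) (hf : ∀ t, t₀ ≤ t → |f t| ≤ B)
    (l : ℕ) {t : ℝ} (ht : t₀ ≤ t) : |dyadicDiff f l t| ≤ 2 ^ l * B := by
  induction l generalizing t with
  | zero => simpa [dyadicDiff_zero] using hf t ht
  | succ l ih =>
    have h1 := ih ht
    have h2 : |dyadicDiff f l (2 * t)| ≤ 2 ^ l * B := ih (by linarith)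
    have h4 : (4⁻¹ : ℝ) ^ l ≤ 1 := pow_le_one₀ (by norm_num) (by norm_num)
    have h3 : |(4⁻¹ : ℝ) ^ l * dyadicDiff f l (2 * t)| ≤ 2 ^ l * B := by
      rw [abs_mul, abs_of_pos (by positivity)]
      calc _ ≤ 1 * |dyadicDiff f l (2 * t)| := by gcongr
        _ ≤ _ := by rwa [one_mul]
    calc _ ≤ _ := abs_sub _ _
      _ ≤ 2 ^ l * B + 2 ^ l * B := add_le_add h1 h3
      _ = _ := by ring

theorem ofReal_dyadicDiff_eq_integral {α : Type*} [MeasurableSpace α] {μ : Measure α}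
    {u : ℝ → ℝ} {k : ℝ → α → ℝ} {Z : α → ℂ}
    (hk : ∀ t, 0 < t → Integrable (fun ξ => (k t ξ : ℂ) * Z ξ) μ)
    (hu : ∀ t, 0 < t → (u t : ℂ) = ∫ ξ, (k t ξ : ℂ) * Z ξ ∂μ) (l : ℕ) {t : ℝ} (ht : 0 < t) :
    Integrable (fun ξ => (dyadicDiff (fun s => k s ξ) l t : ℂ) * Z ξ) μ ∧
    (dyadicDiff u l t : ℂ) = ∫ ξ, (dyadicDiff (fun s => k s ξ) l t : ℂ) * Z ξ ∂μ := by
  induction l generalizing t with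
  | zero => exact ⟨hk t ht, hu t ht⟩
  | succ l ih =>
    obtain ⟨i1, e1⟩ := ih ht
    obtain ⟨i2, e2⟩ := ih (t := 2 * t) (by positivity)
    have i3 := i2.const_mul (((4⁻¹ : ℝ) ^ l : ℝ) : ℂ)
    have e : ∀ ξ, (dyadicDiff (fun s => k s ξ) (l + 1) t : ℂ) * Z ξ =
        (dyadicDiff (fun s => k s ξ) l t : ℂ) * Z ξ -
        (((4⁻¹ : ℝ) ^ l : ℝ) : ℂ) * ((dyadicDiff (fun s => k s ξ) l (2 * t) : ℂ) * Z ξ) := by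
      intro ξ
      rw [dyadicDiff_succ]
      push_cast
      ring
    simp_rw [e]
    refine ⟨i1.sub i3, ?_⟩
    rw [integral_sub i1 i3, integral_const_mul, ← e1, ← e2, dyadicDiff_succ]
    push_cast
    ring

/-- Taylor expansion in powers of `x ^ 2`: passing from `l` to `l + 1` cancels the coefficient of `x
^ (2l)` because `(2x) ^ (2l) = 4 ^ l * x ^ (2l)`. The coefficients must not depend on the range `X`,
since the induction uses the expansion on both `X` and `2X`. -/
theorem exists_dyadicDiff_gaussian_expansion (m l : ℕ) (hl : l ≤ m) :
    ∃ c : ℕ → ℝ, ∀ X : ℝ, ∃ A : ℝ, ∀ x : ℝ, |x| ≤ X →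
      |dyadicDiff (fun t => Real.exp (-t ^ 2)) l x - ∑ i ∈ Finset.Ico l m, c i * (x ^ 2) ^ i| ≤
        A * (x ^ 2) ^ m := by
  induction l with
  | zero =>
    refine ⟨fun i => (-1) ^ i / i.factorial, fun X => ⟨Real.exp (X ^ 2), fun x hx => ?_⟩⟩
    have h := Complex.norm_exp_sub_sum_le_norm_mul_exp ((-x ^ 2 : ℝ) : ℂ) m
    have h2 : ‖((-x ^ 2 : ℝ) : ℂ)‖ = x ^ 2 := by
      rw [Complex.norm_real, Real.norm_eq_abs, abs_neg, abs_of_nonneg (sq_nonneg x)]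
    rw [h2] at h
    have e : Complex.exp ((-x ^ 2 : ℝ) : ℂ) -
        ∑ i ∈ Finset.range m, ((-x ^ 2 : ℝ) : ℂ) ^ i / (i.factorial : ℂ) =
        ((Real.exp (-x ^ 2) - ∑ i ∈ Finset.Ico 0 m, (-1) ^ i / i.factorial * (x ^ 2) ^ i : ℝ) : ℂ) := by
      rw [Nat.Ico_zero_eq_range]
      push_cast
      congr 1
      refine Finset.sum_congr rfl fun i _ => ?_
      rw [neg_pow ((x : ℂ) ^ 2) i]
      ring
    rw [e, Complex.norm_real, Real.norm_eq_abs] at h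
    refine h.trans ?_
    rw [mul_comm]
    refine mul_le_mul_of_nonneg_right (Real.exp_le_exp.2 ?_) (by positivity)
    exact sq_le_sq' (by linarith [neg_abs_le x]) ((le_abs_self x).trans hx)
  | succ l ih =>
    obtain ⟨c, hc⟩ := ih (by omega)
    refine ⟨fun i => c i - (4⁻¹ : ℝ) ^ l * c i * 4 ^ i, fun X => ?_⟩
    obtain ⟨A, hA⟩ := hc X
    obtain ⟨A', hA'⟩ := hc (2 * X)
    refine ⟨A + (4⁻¹ : ℝ) ^ l * A' * 4 ^ m, fun x hx => ?_⟩
    have h1 := hA x hx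
    have h2 := hA' (2 * x) (by rw [abs_mul, abs_two]; linarith)
    set g := dyadicDiff (fun t => Real.exp (-t ^ 2)) l
    have e4 : ∀ i, ((2 * x) ^ 2) ^ i = 4 ^ i * (x ^ 2) ^ i := fun i => by
      rw [mul_pow, mul_pow]; norm_num
    have e : dyadicDiff (fun t => Real.exp (-t ^ 2)) (l + 1) x -
        ∑ i ∈ Finset.Ico (l + 1) m, (c i - (4⁻¹ : ℝ) ^ l * c i * 4 ^ i) * (x ^ 2) ^ i =
        (g x - ∑ i ∈ Finset.Ico l m, c i * (x ^ 2) ^ i) -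
        (4⁻¹ : ℝ) ^ l * (g (2 * x) - ∑ i ∈ Finset.Ico l m, c i * ((2 * x) ^ 2) ^ i) := by
      rw [dyadicDiff_succ]
      have e5 : ∑ i ∈ Finset.Ico (l + 1) m, (c i - (4⁻¹ : ℝ) ^ l * c i * 4 ^ i) * (x ^ 2) ^ i =
          ∑ i ∈ Finset.Ico l m, (c i - (4⁻¹ : ℝ) ^ l * c i * 4 ^ i) * (x ^ 2) ^ i := by
        rw [Finset.sum_eq_sum_Ico_succ_bot (by omega : l < m)]
        have : (4⁻¹ : ℝ) ^ l * c l * 4 ^ l = c l := by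
          rw [mul_right_comm, ← mul_pow]; norm_num
        rw [this]; ring
      rw [e5, mul_sub, Finset.mul_sum]
      have : ∑ i ∈ Finset.Ico l m, (c i - (4⁻¹ : ℝ) ^ l * c i * 4 ^ i) * (x ^ 2) ^ i =
        ∑ i ∈ Finset.Ico l m, c i * (x ^ 2) ^ i -
          ∑ i ∈ Finset.Ico l m, (4⁻¹ : ℝ) ^ l * (c i * ((2 * x) ^ 2) ^ i) := by
        rw [← Finset.sum_sub_distrib]
        refine Finset.sum_congr rfl fun i _ => ?_
        rw [e4]; ring
      rw [this]; ring
    rw [e]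
    calc _ ≤ _ := abs_sub _ _
      _ ≤ A * (x ^ 2) ^ m + (4⁻¹ : ℝ) ^ l * (A' * ((2 * x) ^ 2) ^ m) := by
        rw [abs_mul, abs_of_pos (by positivity : (0:ℝ) < (4⁻¹ : ℝ) ^ l)]
        gcongr
      _ = _ := by rw [e4]; ring

/-- For `|x| ≤ 1` the vanishing of order `2m` wins, as `x ^ (4m) ≤ (x ^ 2) ^ σ`; for `|x| ≥ 1` the
square decays like `exp(-2x²)`. The factor `exp(-x²)` kept on the right is the weight of the later
large-sieve estimate. -/
theorem exists_sq_dyadicDiff_gaussian_le (m : ℕ) :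
    ∃ A : ℝ, 0 < A ∧ ∀ σ : ℝ, 0 ≤ σ → σ ≤ 2 * m → ∀ x : ℝ,
      dyadicDiff (fun t => Real.exp (-t ^ 2)) m x ^ 2 ≤ A * (x ^ 2) ^ σ * Real.exp (-x ^ 2) := by
  obtain ⟨c, hc⟩ := exists_dyadicDiff_gaussian_expansion m m le_rfl
  obtain ⟨A, hA⟩ := hc 1
  refine ⟨A ^ 2 * Real.exp 1 + 4 ^ m, by positivity, fun σ h0 hσ x => ?_⟩
  rcases le_total |x| 1 with hx | hx
  · have h := hA x hx
    simp only [Finset.Ico_self, Finset.sum_empty, sub_zero] at h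
    have hx2 : x ^ 2 ≤ 1 := by rw [← sq_abs]; exact pow_le_one₀ (abs_nonneg x) hx
    calc _ = |dyadicDiff (fun t => Real.exp (-t ^ 2)) m x| ^ 2 := (sq_abs _).symm
      _ ≤ (A * (x ^ 2) ^ m) ^ 2 := by gcongr
      _ = A ^ 2 * (x ^ 2) ^ (2 * m : ℝ) := by
        rw [mul_pow, ← pow_mul, mul_comm m 2, ← Real.rpow_natCast _ (2 * m)]
        push_cast; rfl
      _ ≤ A ^ 2 * (x ^ 2) ^ σ := by
        gcongr ?_ * ?_
        rcases eq_or_lt_of_le (sq_nonneg x) with h' | h'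
        · rw [← h']
          rcases eq_or_lt_of_le h0 with h0 | h0
          · rw [← h0, Real.rpow_zero]
            exact Real.zero_rpow_le_one _
          · rw [Real.zero_rpow (by linarith)]
            positivity
        · exact Real.rpow_le_rpow_of_exponent_ge h' hx2 hσ
      _ = A ^ 2 * (x ^ 2) ^ σ * 1 := (mul_one _).symm
      _ ≤ A ^ 2 * (x ^ 2) ^ σ * (Real.exp 1 * Real.exp (-x ^ 2)) := by
        gcongr
        rw [← Real.exp_add]
        exact Real.one_le_exp (by linarith)
      _ = A ^ 2 * Real.exp 1 * (x ^ 2) ^ σ * Real.exp (-x ^ 2) := by ring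
      _ ≤ _ := by gcongr; linarith [show (0:ℝ) < 4 ^ m by positivity]
  · have hx2 : 1 ≤ x ^ 2 := by rw [← sq_abs]; exact one_le_pow₀ hx
    have h : |dyadicDiff (fun t => Real.exp (-t ^ 2)) m (|x|)| ≤ 2 ^ m * Real.exp (-x ^ 2) := by
      refine abs_dyadicDiff_le (abs_nonneg x) (fun t ht => ?_) m le_rfl
      rw [abs_of_pos (Real.exp_pos _), ← sq_abs x]
      gcongr
    have hs : dyadicDiff (fun t => Real.exp (-t ^ 2)) m (|x|) =
        dyadicDiff (fun t => Real.exp (-t ^ 2)) m x := by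
      rcases abs_choice x with h' | h'
      · rw [h']
      · rw [h', ← neg_one_mul, ← dyadicDiff_comp_mul]
        simp
    rw [hs] at h
    calc _ = |dyadicDiff (fun t => Real.exp (-t ^ 2)) m x| ^ 2 := (sq_abs _).symm
      _ ≤ (2 ^ m * Real.exp (-x ^ 2)) ^ 2 := by gcongr
      _ = 4 ^ m * Real.exp (-x ^ 2) * Real.exp (-x ^ 2) := by
        rw [mul_pow, ← pow_mul, mul_comm m 2, pow_mul]; norm_num; ring
      _ ≤ 4 ^ m * (x ^ 2) ^ σ * Real.exp (-x ^ 2) := by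
        gcongr
        exact (Real.exp_le_one_iff.2 (by linarith)).trans (Real.one_le_rpow hx2 h0)
      _ ≤ _ := by gcongr; linarith [show (0:ℝ) ≤ A ^ 2 * Real.exp 1 by positivity]

/-- If all top-order dyadic differences between the scale of index `0` and that of index `k₀` are
small, then `u` is small at the latter scale. -/
theorem exists_le_abs_dyadicDiff {u : ℝ → ℝ} {t₀ : ℝ} (ht₀ : 0 < t₀) {m : ℕ} {q b η B : ℝ}
    (hq : 1 / 2 ≤ q) (hq1 : q < 1) (hη : ∀ t, t₀ ≤ t → |u t| ≤ η)
    (hηb : 2 ^ m * η ≤ b) (hB : η + 2 ^ m * b * (1 - q)⁻¹ < B) (hm : 0 < m)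
    {k₀ : ℕ} (hk₀ : B ≤ u (t₀ * 2⁻¹ ^ k₀)) :
    ∃ k ≤ k₀, b * q ^ k ≤ |dyadicDiff u m (t₀ * 2⁻¹ ^ k)| := by
  by_contra! hcon
  have hη0 : 0 ≤ η := (abs_nonneg _).trans (hη t₀ le_rfl)
  have hb0 : 0 ≤ b := le_trans (by positivity) hηb
  have hstep : ∀ l k, dyadicDiff u l (t₀ * 2⁻¹ ^ (k + 1)) =
      dyadicDiff u (l + 1) (t₀ * 2⁻¹ ^ (k + 1)) + (4⁻¹ : ℝ) ^ l * dyadicDiff u l (t₀ * 2⁻¹ ^ k) := by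
    intro l k
    have : (2 : ℝ) * (t₀ * 2⁻¹ ^ (k + 1)) = t₀ * 2⁻¹ ^ k := by rw [pow_succ]; ring
    rw [dyadicDiff_succ, this]; ring
  -- Descending in the order of the difference, from `m` down to `1`; each order lost costs a factor
  -- `2`.
  have key : ∀ j, j < m → ∀ k ≤ k₀, |dyadicDiff u (m - j) (t₀ * 2⁻¹ ^ k)| ≤ 2 ^ j * b * q ^ k := by
    intro j
    induction j with
    | zero => intro _ k hk; simpa using (hcon k hk).le
    | succ j ihj =>
      intro hj k
      obtain ⟨l, hl⟩ : ∃ l, m - (j + 1) = l + 1 := ⟨m - j - 2, by omega⟩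
      have hl' : m - j = l + 1 + 1 := by omega
      induction k with
      | zero =>
        intro _
        have := abs_dyadicDiff_le ht₀.le hη (m - (j + 1)) (le_refl t₀)
        simp only [pow_zero, mul_one]
        refine this.trans ?_
        calc (2:ℝ) ^ (m - (j + 1)) * η ≤ 2 ^ m * η := by
              gcongr
              · norm_num
              · omega
          _ ≤ b := hηb
          _ ≤ _ := le_mul_of_one_le_left hb0 (one_le_pow₀ (by norm_num))
      | succ k ihk =>
        intro hk
        have h1 := ihj (by omega) (k + 1) hk
        have h2 := ihk (by omega)
        rw [hl] at h2 ⊢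
        rw [hl'] at h1
        rw [hstep]
        -- At order at least `1` the recursion in `k` contracts by `1/4`, so the rate `q ^ k`
        -- survives: `q + 1/2 ≤ 2q` because `q ≥ 1/2`.
        have h4 : (4⁻¹ : ℝ) ^ (l + 1) ≤ 4⁻¹ := by
          rw [pow_succ]
          exact mul_le_of_le_one_left (by norm_num) (pow_le_one₀ (by norm_num) (by norm_num))
        calc _ ≤ _ := abs_add_le _ _
          _ ≤ 2 ^ j * b * q ^ (k + 1) + 4⁻¹ * (2 ^ (j + 1) * b * q ^ k) := by
            rw [abs_mul, abs_of_pos (by positivity : (0:ℝ) < (4⁻¹ : ℝ) ^ (l + 1))]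
            gcongr
          _ = 2 ^ j * b * q ^ k * (q + 1 / 2) := by ring
          _ ≤ 2 ^ j * b * q ^ k * (2 * q) := by gcongr; linarith
          _ = _ := by ring
  -- At order `0` the recursion has factor `1` and merely telescopes, so the summability of `q ^ i`
  -- is needed.
  have hsum : ∀ k ≤ k₀, u (t₀ * 2⁻¹ ^ k) ≤ η + 2 ^ m * b * ∑ i ∈ Finset.range k, q ^ i := by
    intro k
    induction k with
    | zero => intro _; simpa using (le_abs_self _).trans (hη t₀ le_rfl)
    | succ k ih =>
      intro hk
      have h1 := ih (by omega)
      have h2 := key (m - 1) (by omega) (k + 1) hk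
      rw [show m - (m - 1) = 0 + 1 by omega] at h2
      have h3 := hstep 0 k
      rw [dyadicDiff_zero, dyadicDiff_zero, pow_zero, one_mul] at h3
      have h4 : (2:ℝ) ^ (m - 1) * b * q ^ (k + 1) ≤ 2 ^ m * b * q ^ k := by
        have : q ^ (k + 1) ≤ q ^ k := pow_le_pow_of_le_one (by linarith) hq1.le (by omega)
        gcongr
        · norm_num
        · omega
      rw [h3, Finset.sum_range_succ, mul_add]
      linarith [le_abs_self (dyadicDiff u (0 + 1) (t₀ * 2⁻¹ ^ (k + 1)))]
  have h := hsum k₀ le_rfl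
  have hg : ∑ i ∈ Finset.range k₀, q ^ i ≤ (1 - q)⁻¹ := by
    rw [← tsum_geometric_of_lt_one (by linarith) hq1]
    exact (summable_geometric_of_lt_one (by linarith) hq1).sum_le_tsum _
      (fun i _ => pow_nonneg (by linarith) i)
  have : 2 ^ m * b * ∑ i ∈ Finset.range k₀, q ^ i ≤ 2 ^ m * b * (1 - q)⁻¹ := by gcongr
  linarith

/-! ### Gaussian averages on the Fourier side. -/

/-- The average of `μ` at the point `y` and scale `t` against the `L¹`-normalized Gaussian. -/
noncomputable def gaussianAverage {n : ℕ} (μ : Measure (EuclideanSpace ℝ (Fin n)))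
    (y : EuclideanSpace ℝ (Fin n)) (t : ℝ) : ℝ :=
  t⁻¹ ^ n * ∫ x, Real.exp (-Real.pi * ‖y - x‖ ^ 2 / t ^ 2) ∂μ

/-- The character `ξ ↦ exp(2πi⟨y,ξ⟩)`. -/
noncomputable def planeWave {n : ℕ} (y ξ : EuclideanSpace ℝ (Fin n)) : ℂ :=
  Complex.exp (((2 * Real.pi * inner ℝ y ξ : ℝ) : ℂ) * Complex.I)

section

variable {n : ℕ}

theorem norm_planeWave (y ξ : EuclideanSpace ℝ (Fin n)) : ‖planeWave y ξ‖ = 1 :=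
  Complex.norm_exp_ofReal_mul_I _

theorem planeWave_sub (y z ξ : EuclideanSpace ℝ (Fin n)) :
    planeWave (y - z) ξ = planeWave y ξ * planeWave (-z) ξ := by
  rw [planeWave, planeWave, planeWave, ← Complex.exp_add, inner_sub_left, inner_neg_left]
  push_cast
  congr 1
  ring

theorem conj_planeWave (y ξ : EuclideanSpace ℝ (Fin n)) :
    (starRingEnd ℂ) (planeWave y ξ) = planeWave (-y) ξ := by
  rw [planeWave, planeWave, ← Complex.exp_conj, inner_neg_left, map_mul, Complex.conj_ofReal,
    Complex.conj_I]
  push_cast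
  congr 1
  ring

theorem continuous_planeWave :
    Continuous fun p : EuclideanSpace ℝ (Fin n) × EuclideanSpace ℝ (Fin n) =>
      planeWave p.1 p.2 := by
  unfold planeWave
  fun_prop

theorem continuous_planeWave_right (y : EuclideanSpace ℝ (Fin n)) : Continuous (planeWave y) :=
  continuous_planeWave.comp (by fun_prop : Continuous fun ξ => (y, ξ))

theorem fourierMeasure_eq_integral_planeWave (μ : Measure (EuclideanSpace ℝ (Fin n)))
    (ξ : EuclideanSpace ℝ (Fin n)) : fourierMeasure μ ξ = ∫ x, planeWave (-x) ξ ∂μ := by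
  simp only [fourierMeasure, planeWave, inner_neg_left]
  congr! 4
  ring_nf

theorem continuous_fourierMeasure (μ : Measure (EuclideanSpace ℝ (Fin n))) [IsFiniteMeasure μ] :
    Continuous (fourierMeasure μ) := by
  rw [show fourierMeasure μ = fun ξ => ∫ x, planeWave (-x) ξ ∂μ from
    funext (fourierMeasure_eq_integral_planeWave μ)]
  refine continuous_of_dominated (bound := fun _ => 1) (fun ξ => ?_) (fun ξ => ?_)
    (integrable_const _) ?_
  · exact (continuous_planeWave.comp
      (continuous_neg.prodMk continuous_const)).aestronglyMeasurable
  · exact Filter.Eventually.of_forall fun x => (norm_planeWave _ _).le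
  · exact Filter.Eventually.of_forall fun x => continuous_planeWave_right _

theorem norm_fourierMeasure_le (μ : Measure (EuclideanSpace ℝ (Fin n))) [IsFiniteMeasure μ]
    (ξ : EuclideanSpace ℝ (Fin n)) : ‖fourierMeasure μ ξ‖ ≤ μ.real Set.univ := by
  rw [fourierMeasure_eq_integral_planeWave]
  simpa using norm_integral_le_of_norm_le_const (μ := μ) (C := 1)
    (Filter.Eventually.of_forall fun x => (norm_planeWave (-x) ξ).le)

theorem integrable_gaussian {t : ℝ} (ht : 0 < t) :
    Integrable fun ξ : EuclideanSpace ℝ (Fin n) => Real.exp (-Real.pi * t ^ 2 * ‖ξ‖ ^ 2) := by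
  have h := GaussianFourier.integrable_cexp_neg_mul_sq_norm_add
    (V := EuclideanSpace ℝ (Fin n)) (b := (Real.pi * t ^ 2 : ℝ))
    (by rw [Complex.ofReal_re]; positivity) 0 0
  refine h.norm.congr (Filter.Eventually.of_forall fun ξ => ?_)
  simp only [Complex.norm_exp]
  congr 1
  rw [zero_mul, add_zero, ← Complex.ofReal_neg, ← Complex.ofReal_pow, ← Complex.ofReal_mul,
    Complex.ofReal_re]
  ring

theorem integral_gaussian_mul_planeWave {t : ℝ} (ht : 0 < t) (y : EuclideanSpace ℝ (Fin n)) :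
    ∫ ξ, (Real.exp (-Real.pi * t ^ 2 * ‖ξ‖ ^ 2) : ℂ) * planeWave y ξ =
      ((t⁻¹ ^ n * Real.exp (-Real.pi * ‖y‖ ^ 2 / t ^ 2) : ℝ) : ℂ) := by
  have h := GaussianFourier.integral_cexp_neg_mul_sq_norm_add
    (V := EuclideanSpace ℝ (Fin n)) (b := (Real.pi * t ^ 2 : ℝ))
    (by rw [Complex.ofReal_re]; positivity) (2 * Real.pi * Complex.I) y
  have e1 : ∀ ξ : EuclideanSpace ℝ (Fin n),
      (Real.exp (-Real.pi * t ^ 2 * ‖ξ‖ ^ 2) : ℂ) * planeWave y ξ =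
      Complex.exp (-((Real.pi * t ^ 2 : ℝ) : ℂ) * (‖ξ‖ : ℂ) ^ 2 +
        2 * Real.pi * Complex.I * (inner ℝ y ξ : ℝ)) := by
    intro ξ
    rw [planeWave, Complex.ofReal_exp, ← Complex.exp_add]
    push_cast
    congr 1
    ring
  simp_rw [e1]
  rw [h]
  have hpi := Real.pi_pos
  have e2 : (Real.pi : ℂ) / ((Real.pi * t ^ 2 : ℝ) : ℂ) = ((t⁻¹ ^ 2 : ℝ) : ℂ) := by
    rw [← Complex.ofReal_div]
    congr 1
    field_simp
  have e3 : ((Module.finrank ℝ (EuclideanSpace ℝ (Fin n)) : ℂ) / 2) = (((n : ℝ) / 2 : ℝ) : ℂ) := by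
    simp
  have e4 : (t⁻¹ ^ 2 : ℝ) ^ ((n : ℝ) / 2) = t⁻¹ ^ n := by
    rw [← Real.rpow_natCast t⁻¹ 2, ← Real.rpow_mul (by positivity), ← Real.rpow_natCast t⁻¹ n]
    congr 1
    push_cast
    ring
  have e5 : (2 * Real.pi * Complex.I) ^ 2 * (‖y‖ : ℂ) ^ 2 / (4 * ((Real.pi * t ^ 2 : ℝ) : ℂ)) =
      ((-Real.pi * ‖y‖ ^ 2 / t ^ 2 : ℝ) : ℂ) := by
    have : (t : ℂ) ≠ 0 := by exact_mod_cast ht.ne'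
    have : (Real.pi : ℂ) ≠ 0 := by exact_mod_cast hpi.ne'
    rw [mul_pow, Complex.I_sq]
    push_cast
    field_simp
    ring
  rw [e2, e3, e5, ← Complex.ofReal_cpow (by positivity), e4, ← Complex.ofReal_exp,
    ← Complex.ofReal_mul]

theorem integrable_gaussian_mul {t : ℝ} (ht : 0 < t) {Z : EuclideanSpace ℝ (Fin n) → ℂ}
    (hZ : Continuous Z) {B : ℝ} (hB : ∀ ξ, ‖Z ξ‖ ≤ B) :
    Integrable fun ξ => (Real.exp (-Real.pi * t ^ 2 * ‖ξ‖ ^ 2) : ℂ) * Z ξ :=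
  (integrable_gaussian ht).ofReal.mul_bdd hZ.aestronglyMeasurable
    (Filter.Eventually.of_forall hB)

theorem gaussianAverage_eq_integral (μ : Measure (EuclideanSpace ℝ (Fin n))) [IsFiniteMeasure μ]
    {t : ℝ} (ht : 0 < t) (y : EuclideanSpace ℝ (Fin n)) :
    (gaussianAverage μ y t : ℂ) =
      ∫ ξ, (Real.exp (-Real.pi * t ^ 2 * ‖ξ‖ ^ 2) : ℂ) * (planeWave y ξ * fourierMeasure μ ξ) := by
  have e1 : ∀ ξ, (Real.exp (-Real.pi * t ^ 2 * ‖ξ‖ ^ 2) : ℂ) *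
      (planeWave y ξ * fourierMeasure μ ξ) =
      ∫ x, (Real.exp (-Real.pi * t ^ 2 * ‖ξ‖ ^ 2) : ℂ) * planeWave (y - x) ξ ∂μ := by
    intro ξ
    simp_rw [planeWave_sub]
    rw [fourierMeasure_eq_integral_planeWave, integral_const_mul, integral_const_mul]
  simp_rw [e1]
  rw [integral_integral_swap]
  · simp_rw [integral_gaussian_mul_planeWave ht]
    rw [integral_complex_ofReal, integral_const_mul]
    rfl
  · have h := (integrable_gaussian (n := n) ht).ofReal (𝕜 := ℂ) |>.comp_fst μ
    refine h.mul_bdd (c := 1) ?_ (Filter.Eventually.of_forall fun p => (norm_planeWave _ _).le)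
    exact (continuous_planeWave.comp (by fun_prop :
      Continuous fun p : EuclideanSpace ℝ (Fin n) × EuclideanSpace ℝ (Fin n) =>
        (y - p.2, p.1))).aestronglyMeasurable

theorem dyadicDiff_gaussian_scale (m : ℕ) (ξ : EuclideanSpace ℝ (Fin n)) (t : ℝ) :
    dyadicDiff (fun s => Real.exp (-Real.pi * s ^ 2 * ‖ξ‖ ^ 2)) m t =
      dyadicDiff (fun s => Real.exp (-s ^ 2)) m (√Real.pi * ‖ξ‖ * t) := by
  rw [← dyadicDiff_comp_mul]
  congr 1
  ext s
  congr 1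
  rw [mul_pow, mul_pow, Real.sq_sqrt Real.pi_pos.le]
  ring

/-! ### The large-sieve inequality. -/

theorem integral_gaussian_mul_norm_sq {ι : Type*} (T : Finset ι) (a : ι → ℝ)
    (y : ι → EuclideanSpace ℝ (Fin n)) {t : ℝ} (ht : 0 < t) :
    Integrable (fun ξ => Real.exp (-Real.pi * t ^ 2 * ‖ξ‖ ^ 2) *
      ‖∑ i ∈ T, (a i : ℂ) * planeWave (y i) ξ‖ ^ 2) ∧
    ∫ ξ, Real.exp (-Real.pi * t ^ 2 * ‖ξ‖ ^ 2) * ‖∑ i ∈ T, (a i : ℂ) * planeWave (y i) ξ‖ ^ 2 =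
      t⁻¹ ^ n * ∑ i ∈ T, ∑ j ∈ T, a i * a j * Real.exp (-Real.pi * ‖y i - y j‖ ^ 2 / t ^ 2) := by
  have hc : Continuous fun ξ => ∑ i ∈ T, (a i : ℂ) * planeWave (y i) ξ :=
    continuous_finsetSum _ fun i _ => continuous_const.mul (continuous_planeWave_right _)
  constructor
  · refine (integrable_gaussian ht).mul_bdd (c := (∑ i ∈ T, |a i|) ^ 2)
      (hc.norm.pow 2).aestronglyMeasurable (Filter.Eventually.of_forall fun ξ => ?_)
    rw [norm_pow, norm_norm]
    gcongr
    refine (norm_sum_le _ _).trans (Finset.sum_le_sum fun i _ => ?_)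
    rw [norm_mul, norm_planeWave, mul_one, Complex.norm_real, Real.norm_eq_abs]
  · rw [← Complex.ofReal_inj, ← integral_complex_ofReal]
    have e : ∀ ξ, ((Real.exp (-Real.pi * t ^ 2 * ‖ξ‖ ^ 2) *
        ‖∑ i ∈ T, (a i : ℂ) * planeWave (y i) ξ‖ ^ 2 : ℝ) : ℂ) =
        ∑ i ∈ T, ∑ j ∈ T, ((a i : ℂ) * a j) *
          ((Real.exp (-Real.pi * t ^ 2 * ‖ξ‖ ^ 2) : ℂ) * planeWave (y i - y j) ξ) := by
      intro ξ
      rw [Complex.ofReal_mul, Complex.ofReal_pow, ← Complex.mul_conj', map_sum, Finset.sum_mul_sum,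
        Finset.mul_sum]
      refine Finset.sum_congr rfl fun i _ => ?_
      rw [Finset.mul_sum]
      refine Finset.sum_congr rfl fun j _ => ?_
      rw [map_mul, conj_planeWave, Complex.conj_ofReal, planeWave_sub]
      ring
    simp_rw [e]
    have hi : ∀ i j, Integrable fun ξ => ((a i : ℂ) * a j) *
          ((Real.exp (-Real.pi * t ^ 2 * ‖ξ‖ ^ 2) : ℂ) * planeWave (y i - y j) ξ) := fun i j =>
      (integrable_gaussian_mul ht (continuous_planeWave_right _)
        fun ξ => (norm_planeWave _ ξ).le).const_mul _
    rw [integral_finsetSum _ fun i _ => integrable_finsetSum _ fun j _ => hi i j, Finset.mul_sum,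
      Complex.ofReal_sum]
    refine Finset.sum_congr rfl fun i _ => ?_
    rw [integral_finsetSum _ fun j _ => hi i j, Finset.mul_sum, Complex.ofReal_sum]
    refine Finset.sum_congr rfl fun j _ => ?_
    rw [integral_const_mul, integral_gaussian_mul_planeWave ht]
    push_cast
    ring

/-- Schur's test, from `2 a_i a_j ≤ a_i² + a_j²` and the symmetry of `g`. -/
theorem sum_sum_mul_mul_le {ι : Type*} (T : Finset ι) (a : ι → ℝ) (g : ι → ι → ℝ) {B : ℝ}
    (hg0 : ∀ i j, 0 ≤ g i j) (hg : ∀ i j, g i j = g j i) (hB : ∀ i ∈ T, ∑ j ∈ T, g i j ≤ B) :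
    ∑ i ∈ T, ∑ j ∈ T, a i * a j * g i j ≤ B * ∑ i ∈ T, a i ^ 2 := by
  have h1 : ∑ i ∈ T, ∑ j ∈ T, a i ^ 2 * g i j ≤ B * ∑ i ∈ T, a i ^ 2 := by
    rw [Finset.mul_sum]
    refine Finset.sum_le_sum fun i hi => ?_
    rw [← Finset.mul_sum, mul_comm]
    exact mul_le_mul_of_nonneg_right (hB i hi) (sq_nonneg _)
  have h2 : ∑ i ∈ T, ∑ j ∈ T, a j ^ 2 * g i j ≤ B * ∑ i ∈ T, a i ^ 2 := by
    rw [Finset.sum_comm]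
    simpa only [hg] using h1
  have h3 : ∑ i ∈ T, ∑ j ∈ T, a i * a j * g i j ≤
      ∑ i ∈ T, ∑ j ∈ T, (2⁻¹ * (a i ^ 2 * g i j) + 2⁻¹ * (a j ^ 2 * g i j)) := by
    refine Finset.sum_le_sum fun i _ => Finset.sum_le_sum fun j _ => ?_
    nlinarith [mul_nonneg (sq_nonneg (a i - a j)) (hg0 i j)]
  have h4 : ∑ i ∈ T, ∑ j ∈ T, (2⁻¹ * (a i ^ 2 * g i j) + 2⁻¹ * (a j ^ 2 * g i j)) =
      2⁻¹ * ∑ i ∈ T, ∑ j ∈ T, a i ^ 2 * g i j + 2⁻¹ * ∑ i ∈ T, ∑ j ∈ T, a j ^ 2 * g i j := by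
    rw [Finset.mul_sum, Finset.mul_sum, ← Finset.sum_add_distrib]
    refine Finset.sum_congr rfl fun i _ => ?_
    rw [Finset.sum_add_distrib, Finset.mul_sum, Finset.mul_sum]
  linarith

/-- Duality: with `a i` the differences themselves, `∑ a i ^ 2` is the integral of the multiplier
times `μ̂` times the exponential sum `P = ∑ a i * planeWave (y i)`. A weighted Cauchy–Schwarz splits
off the Sobolev norm, and the remaining Gaussian integral of `‖P‖ ^ 2` is a quadratic form in `a`
controlled by Schur's test. -/
theorem sum_sq_dyadicDiff_gaussianAverage_le {m : ℕ} {A σ : ℝ} (hσ : 0 ≤ σ)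
    (hA : ∀ x : ℝ,
      dyadicDiff (fun t => Real.exp (-t ^ 2)) m x ^ 2 ≤ A * (x ^ 2) ^ σ * Real.exp (-x ^ 2))
    (hA0 : 0 ≤ A) (μ : Measure (EuclideanSpace ℝ (Fin n))) [IsFiniteMeasure μ]
    (hN : sobolevNormSq σ μ ≠ ∞) {ι : Type*} (T : Finset ι)
    (y : ι → EuclideanSpace ℝ (Fin n)) {t : ℝ} (ht : 0 < t) {B : ℝ} (hB0 : 0 < B)
    (hB : ∀ i ∈ T, ∑ j ∈ T, Real.exp (-Real.pi * ‖y i - y j‖ ^ 2 / t ^ 2) ≤ B) :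
    ∑ i ∈ T, dyadicDiff (gaussianAverage μ (y i)) m t ^ 2 ≤
      A * Real.pi ^ σ * (t ^ 2) ^ σ * t⁻¹ ^ n * B * (sobolevNormSq σ μ).toReal := by
  set a : ι → ℝ := fun i => dyadicDiff (gaussianAverage μ (y i)) m t with ha
  set P : EuclideanSpace ℝ (Fin n) → ℂ := fun ξ => ∑ i ∈ T, (a i : ℂ) * planeWave (y i) ξ with hP
  set h : EuclideanSpace ℝ (Fin n) → ℝ := fun ξ =>
    dyadicDiff (fun s => Real.exp (-s ^ 2)) m (√Real.pi * ‖ξ‖ * t) with hh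
  set W : EuclideanSpace ℝ (Fin n) → ℝ := fun ξ =>
    ‖fourierMeasure μ ξ‖ ^ 2 * (1 + ‖ξ‖ ^ 2) ^ σ with hW
  set N := (sobolevNormSq σ μ).toReal with hNdef
  set S := ∑ i ∈ T, a i ^ 2 with hS
  have hcF := continuous_fourierMeasure μ
  have hcW : Continuous W := by
    have : Continuous fun ξ : EuclideanSpace ℝ (Fin n) => (1 + ‖ξ‖ ^ 2) ^ σ :=
      Continuous.rpow_const (by fun_prop) fun ξ => Or.inl (by positivity)
    fun_prop
  have hW0 : ∀ ξ, 0 ≤ W ξ := fun ξ => by positivity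
  have hWe : ∀ ξ, ENNReal.ofReal (W ξ) =
      ‖fourierMeasure μ ξ‖ₑ ^ 2 * ENNReal.ofReal ((1 + ‖ξ‖ ^ 2) ^ σ) := fun ξ => by
    rw [hW, ENNReal.ofReal_mul (by positivity), ENNReal.ofReal_pow (norm_nonneg _), ofReal_norm]
  have hWN : ∫ ξ, W ξ = N := by
    rw [integral_eq_lintegral_of_nonneg_ae (Filter.Eventually.of_forall hW0)
      hcW.aestronglyMeasurable, hNdef, sobolevNormSq]
    simp_rw [hWe]
  have hWi : Integrable W := by
    refine ⟨hcW.aestronglyMeasurable, ?_⟩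
    rw [hasFiniteIntegral_iff_ofReal (Filter.Eventually.of_forall hW0)]
    simp_rw [hWe]
    exact lt_top_iff_ne_top.2 hN
  have hrep : ∀ i, Integrable (fun ξ => (h ξ : ℂ) * (planeWave (y i) ξ * fourierMeasure μ ξ)) ∧
      (a i : ℂ) = ∫ ξ, (h ξ : ℂ) * (planeWave (y i) ξ * fourierMeasure μ ξ) := by
    intro i
    have := ofReal_dyadicDiff_eq_integral (μ := volume) (u := gaussianAverage μ (y i))
      (k := fun t ξ => Real.exp (-Real.pi * t ^ 2 * ‖ξ‖ ^ 2))
      (Z := fun ξ => planeWave (y i) ξ * fourierMeasure μ ξ)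
      (fun t ht => integrable_gaussian_mul ht ((continuous_planeWave_right _).mul hcF)
        (B := μ.real Set.univ) fun ξ => by
          rw [norm_mul, norm_planeWave, one_mul]
          exact norm_fourierMeasure_le μ ξ)
      (fun t ht => gaussianAverage_eq_integral μ ht (y i)) m ht
    simpa only [dyadicDiff_gaussian_scale] using this
  have hSrep : (S : ℂ) = ∫ ξ, (h ξ : ℂ) * fourierMeasure μ ξ * P ξ := by
    have e : ∀ ξ, (h ξ : ℂ) * fourierMeasure μ ξ * P ξ =
        ∑ i ∈ T, (a i : ℂ) * ((h ξ : ℂ) * (planeWave (y i) ξ * fourierMeasure μ ξ)) := by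
      intro ξ
      rw [hP, Finset.mul_sum]
      exact Finset.sum_congr rfl fun i _ => by ring
    simp_rw [e]
    rw [integral_finsetSum _ fun i _ => (hrep i).1.const_mul _, hS]
    push_cast
    refine Finset.sum_congr rfl fun i _ => ?_
    rw [integral_const_mul, ← (hrep i).2]
    ring
  obtain ⟨hQi, hQ⟩ := integral_gaussian_mul_norm_sq T a y ht
  have hQle := sum_sum_mul_mul_le T a
    (fun i j => Real.exp (-Real.pi * ‖y i - y j‖ ^ 2 / t ^ 2)) (fun i j => (Real.exp_pos _).le)
    (fun i j => by rw [norm_sub_rev]) hB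
  set A' := A * Real.pi ^ σ * (t ^ 2) ^ σ with hA'
  have hhsq : ∀ ξ, h ξ ^ 2 ≤
      A' * (1 + ‖ξ‖ ^ 2) ^ σ * Real.exp (-Real.pi * t ^ 2 * ‖ξ‖ ^ 2) := by
    intro ξ
    have e : (√Real.pi * ‖ξ‖ * t) ^ 2 = Real.pi * t ^ 2 * ‖ξ‖ ^ 2 := by
      rw [mul_pow, mul_pow, Real.sq_sqrt Real.pi_pos.le]
      ring
    refine (hA _).trans ?_
    rw [e, hA', Real.mul_rpow (by positivity) (by positivity),
      Real.mul_rpow (by positivity) (by positivity), neg_mul, neg_mul]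
    rw [← mul_assoc, ← mul_assoc]
    gcongr
    linarith
  -- Weight for the arithmetic–geometric inequality, chosen so that the `P` term contributes at most
  -- `S` and is absorbed by the left side `2 * S`.
  set L := t⁻¹ ^ n * B with hL
  have hL0 : 0 < L := by positivity
  have hpt : ∀ ξ, 2 * ‖(h ξ : ℂ) * fourierMeasure μ ξ * P ξ‖ ≤
      L * A' * W ξ + L⁻¹ * (Real.exp (-Real.pi * t ^ 2 * ‖ξ‖ ^ 2) * ‖P ξ‖ ^ 2) := by
    intro ξ
    set G := Real.exp (-Real.pi * t ^ 2 * ‖ξ‖ ^ 2) with hG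
    have hG0 : 0 < G := Real.exp_pos _
    rw [norm_mul, norm_mul, Complex.norm_real, Real.norm_eq_abs]
    have hx : (|h ξ| * ‖fourierMeasure μ ξ‖) ^ 2 ≤ A' * W ξ * G := by
      rw [mul_pow, sq_abs]
      calc _ ≤ (A' * (1 + ‖ξ‖ ^ 2) ^ σ * G) * ‖fourierMeasure μ ξ‖ ^ 2 := by
            gcongr
            exact hhsq ξ
        _ = _ := by rw [hW]; ring
    have h2 := sq_nonneg (|h ξ| * ‖fourierMeasure μ ξ‖ * L - G * ‖P ξ‖)
    have h3 : 2 * (|h ξ| * ‖fourierMeasure μ ξ‖ * ‖P ξ‖) * (G * L) ≤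
        (L * A' * W ξ + L⁻¹ * (G * ‖P ξ‖ ^ 2)) * (G * L) := by
      have e : (L * A' * W ξ + L⁻¹ * (G * ‖P ξ‖ ^ 2)) * (G * L) =
        L ^ 2 * (A' * W ξ * G) + (G * ‖P ξ‖) ^ 2 := by
        field_simp
      rw [e]
      nlinarith [mul_le_mul_of_nonneg_left hx (sq_nonneg L)]
    exact le_of_mul_le_mul_right h3 (by positivity)
  have hfin : 2 * S ≤ L * A' * N + L⁻¹ * (t⁻¹ ^ n * (B * S)) := by
    have h1 : S ≤ ∫ ξ, ‖(h ξ : ℂ) * fourierMeasure μ ξ * P ξ‖ := by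
      calc S ≤ ‖(S : ℂ)‖ := by rw [Complex.norm_real]; exact le_abs_self S
        _ ≤ _ := by rw [hSrep]; exact norm_integral_le_integral_norm _
    calc 2 * S ≤ 2 * ∫ ξ, ‖(h ξ : ℂ) * fourierMeasure μ ξ * P ξ‖ := by gcongr
      _ = ∫ ξ, 2 * ‖(h ξ : ℂ) * fourierMeasure μ ξ * P ξ‖ := (integral_const_mul _ _).symm
      _ ≤ ∫ ξ, (L * A' * W ξ + L⁻¹ * (Real.exp (-Real.pi * t ^ 2 * ‖ξ‖ ^ 2) * ‖P ξ‖ ^ 2)) :=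
        integral_mono_of_nonneg (Filter.Eventually.of_forall fun ξ => by positivity)
          ((hWi.const_mul _).add (hQi.const_mul _)) (Filter.Eventually.of_forall hpt)
      _ = L * A' * N + L⁻¹ * (t⁻¹ ^ n * ∑ i ∈ T, ∑ j ∈ T,
          a i * a j * Real.exp (-Real.pi * ‖y i - y j‖ ^ 2 / t ^ 2)) := by
        rw [integral_add (hWi.const_mul _) (hQi.const_mul _), integral_const_mul,
          integral_const_mul, hWN, hQ]
      _ ≤ _ := by gcongr
  have : L⁻¹ * (t⁻¹ ^ n * (B * S)) = S := by
    rw [← mul_assoc (t⁻¹ ^ n), inv_mul_cancel_left₀ hL0.ne']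
  rw [this] at hfin
  calc S ≤ L * A' * N := by linarith
    _ = _ := by rw [hL]; ring

end

/-! ### Hausdorff content and coverings. -/

theorem hausdorffContent_mono {X : Type*} [PseudoEMetricSpace X] (t : ℝ) {A B : Set X}
    (h : A ⊆ B) : hausdorffContent t A ≤ hausdorffContent t B :=
  le_iInf₂ fun U hU => iInf₂_le U (h.trans hU)

theorem hausdorffContent_le_tsum {X ι : Type*} [PseudoEMetricSpace X] [Countable ι] {t : ℝ}
    (ht : 0 < t) {A : Set X} (U : ι → Set X) (hA : A ⊆ ⋃ i, U i) :
    hausdorffContent t A ≤ ∑' i, Metric.ediam (U i) ^ t := by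
  have := Encodable.ofCountable ι
  refine (iInf₂_le (fun n => ⋃ b ∈ Encodable.decode₂ ι n, U b) ?_).trans ?_
  · rwa [Encodable.iUnion_decode₂]
  · exact (tsum_iUnion_decode₂ (fun s : Set X => Metric.ediam s ^ t)
      (by simp [ENNReal.zero_rpow_of_pos ht]) U).le

theorem hausdorffContent_subsingleton {X : Type*} [PseudoEMetricSpace X] {t : ℝ} (ht : 0 < t)
    {A : Set X} (hA : A.Subsingleton) : hausdorffContent t A = 0 := by
  refine le_antisymm ((hausdorffContent_le_tsum ht (fun _ : Unit => A)
    (Set.subset_iUnion (fun _ : Unit => A) ())).trans ?_) zero_le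
  simp [Metric.ediam_subsingleton hA, ENNReal.zero_rpow_of_pos ht]

theorem hausdorffContent_le_tsum_card {X : Type*} [PseudoMetricSpace X] {τ : ℝ} (hτ : 0 < τ)
    {A : Set X} (T : ℕ → Finset X) (t : ℕ → ℝ) (ht : ∀ j, 0 ≤ t j)
    (hA : A ⊆ ⋃ j, ⋃ x ∈ T j, Metric.closedBall x (t j)) :
    hausdorffContent τ A ≤ ∑' j, ENNReal.ofReal ((T j).card * (2 * t j) ^ τ) := by
  refine (hausdorffContent_le_tsum hτ
    (fun i : Σ j, {x // x ∈ T j} => Metric.closedBall (i.2 : X) (t i.1)) ?_).trans ?_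
  · refine hA.trans fun x hx => ?_
    simp only [Set.mem_iUnion] at hx ⊢
    obtain ⟨j, z, hz, hx⟩ := hx
    exact ⟨⟨j, z, hz⟩, hx⟩
  · rw [ENNReal.tsum_sigma']
    refine ENNReal.tsum_le_tsum fun j => ?_
    rw [tsum_fintype]
    have h : ∀ x : {x // x ∈ T j}, Metric.ediam (Metric.closedBall (x : X) (t j)) ^ τ ≤
        ENNReal.ofReal ((2 * t j) ^ τ) := by
      intro x
      rw [← ENNReal.ofReal_rpow_of_nonneg (by linarith [ht j]) hτ.le]
      gcongr
      refine Metric.ediam_le fun y hy z hz => ?_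
      rw [edist_dist]
      gcongr
      linarith [dist_triangle_right y z (x : X), Metric.mem_closedBall.1 hy,
        Metric.mem_closedBall.1 hz]
    refine (Finset.sum_le_sum fun x _ => h x).trans ?_
    rw [Finset.sum_const, Finset.card_univ, Fintype.card_coe, nsmul_eq_mul,
      ENNReal.ofReal_mul (by positivity), ENNReal.ofReal_natCast]

/-- A separated subset of maximal cardinality is a `t`-net, and the uniform bound on cardinalities
makes the maximum exist. -/
theorem exists_finset_cover_of_card_le {X : Type*} [PseudoMetricSpace X] (A : Set X) {t c : ℝ}
    (ht : 0 ≤ t) (h : ∀ T : Finset X, ↑T ⊆ A → (T : Set X).Pairwise (fun x y => t < dist x y) →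
      (T.card : ℝ) ≤ c) :
    ∃ T : Finset X, (T.card : ℝ) ≤ c ∧ A ⊆ ⋃ x ∈ T, Metric.closedBall x t := by
  classical
  set S : Set ℕ := {k | ∃ T : Finset X, ↑T ⊆ A ∧
    (T : Set X).Pairwise (fun x y => t < dist x y) ∧ T.card = k} with hS
  have hne : S.Nonempty := ⟨0, ∅, by simp, by simp, rfl⟩
  have hbdd : BddAbove S := by
    refine ⟨⌊c⌋₊, ?_⟩
    rintro k ⟨T, h1, h2, rfl⟩
    exact Nat.le_floor (h T h1 h2)
  obtain ⟨T, h1, h2, h3⟩ := Nat.sSup_mem hne hbdd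
  refine ⟨T, h T h1 h2, fun x hx => ?_⟩
  by_contra hcon
  simp only [Set.mem_iUnion, Metric.mem_closedBall, not_exists, not_le] at hcon
  have hxT : x ∉ T := fun hxT => by
    have := hcon x hxT
    rw [dist_self] at this
    linarith
  have : (insert x T).card ∈ S := by
    refine ⟨insert x T, ?_, ?_, rfl⟩
    · rw [Finset.coe_insert]
      exact Set.insert_subset hx h1
    · rw [Finset.coe_insert]
      refine h2.insert fun y hy _ => ⟨hcon y hy, ?_⟩
      rw [dist_comm]
      exact hcon y hy
  have := le_csSup hbdd this
  rw [Finset.card_insert_of_notMem hxT] at this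
  omega

/-! ### Gaussian averages, separated points and the maximal function. -/

section

variable {n : ℕ}

theorem gaussianAverage_nonneg (μ : Measure (EuclideanSpace ℝ (Fin n)))
    (y : EuclideanSpace ℝ (Fin n)) {t : ℝ} (ht : 0 < t) : 0 ≤ gaussianAverage μ y t :=
  mul_nonneg (by positivity) (integral_nonneg fun _ => (Real.exp_pos _).le)

theorem exp_neg_mul_sq_div_le_one (a t : ℝ) : Real.exp (-Real.pi * a ^ 2 / t ^ 2) ≤ 1 := by
  rw [Real.exp_le_one_iff, neg_mul, neg_div, neg_nonpos]
  positivity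

theorem integrable_exp_neg_dist_sq {α : Type*} [MeasurableSpace α] (μ : Measure α)
    [IsFiniteMeasure μ] {f : α → EuclideanSpace ℝ (Fin n)} (hf : Measurable f)
    (y : EuclideanSpace ℝ (Fin n)) (t : ℝ) :
    Integrable (fun x => Real.exp (-Real.pi * ‖y - f x‖ ^ 2 / t ^ 2)) μ := by
  refine Integrable.of_bound (by fun_prop) 1 (Filter.Eventually.of_forall fun x => ?_)
  rw [Real.norm_eq_abs, abs_of_pos (Real.exp_pos _)]
  exact exp_neg_mul_sq_div_le_one _ _

theorem gaussianAverage_le (μ : Measure (EuclideanSpace ℝ (Fin n))) [IsFiniteMeasure μ]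
    (y : EuclideanSpace ℝ (Fin n)) {t : ℝ} (ht : 0 < t) :
    gaussianAverage μ y t ≤ t⁻¹ ^ n * μ.real Set.univ := by
  rw [gaussianAverage]
  gcongr
  calc _ ≤ ∫ _, (1 : ℝ) ∂μ :=
        integral_mono (integrable_exp_neg_dist_sq μ measurable_id y t) (integrable_const _)
          fun x => exp_neg_mul_sq_div_le_one _ _
    _ = _ := by simp

theorem le_gaussianAverage (μ : Measure (EuclideanSpace ℝ (Fin n))) [IsFiniteMeasure μ]
    (y : EuclideanSpace ℝ (Fin n)) {r t : ℝ} (ht : 0 < t) (hrt : r ≤ t) :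
    t⁻¹ ^ n * (Real.exp (-Real.pi) * μ.real (Metric.ball y r)) ≤ gaussianAverage μ y t := by
  rw [gaussianAverage]
  gcongr
  have hi := integrable_exp_neg_dist_sq μ measurable_id y t
  refine le_trans ?_ (setIntegral_le_integral (s := Metric.ball y r) hi
    (Filter.Eventually.of_forall fun x => (Real.exp_pos _).le))
  rw [mul_comm, ← smul_eq_mul, ← setIntegral_const]
  refine setIntegral_mono_on (integrable_const _).integrableOn hi.integrableOn
    Metric.isOpen_ball.measurableSet fun x hx => ?_
  rw [Real.exp_le_exp, neg_mul, neg_div, neg_le_neg_iff, mul_div_assoc]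
  refine mul_le_of_le_one_right Real.pi_pos.le ?_
  rw [div_le_one (by positivity)]
  gcongr
  rw [← dist_eq_norm, dist_comm]
  exact (Metric.mem_ball.1 hx).le.trans hrt

/-- A Gaussian sum over the projections of a separated set is controlled by the Gaussian average of
the projected measure, if the measure has a lower bound on small balls. -/
theorem sum_exp_neg_dist_sq_le {X : Type*} [PseudoMetricSpace X] [MeasurableSpace X] [BorelSpace X]
    (ν : Measure X) [IsFiniteMeasure ν] {p : X → EuclideanSpace ℝ (Fin n)}
    (hp : LipschitzWith 1 p) (T : Finset X) {t r b : ℝ} (ht : 0 < t) (hr : 2 * r ≤ t)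
    (hT : (T : Set X).Pairwise fun x y => t < dist x y)
    (hb : ∀ x ∈ T, b ≤ ν.real (Metric.ball x r)) (y : EuclideanSpace ℝ (Fin n)) :
    b * ∑ x ∈ T, Real.exp (-Real.pi * ‖y - p x‖ ^ 2 / t ^ 2) ≤
      Real.exp Real.pi * (2 * t) ^ n * gaussianAverage (ν.map p) y (2 * t) := by
  set G : X → ℝ := fun z => Real.exp (-Real.pi * ‖y - p z‖ ^ 2 / (2 * t) ^ 2) with hG
  have hpm : Measurable p := hp.continuous.measurable
  have hGi : Integrable G ν := integrable_exp_neg_dist_sq ν hpm y (2 * t)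
  have hG0 : ∀ z, 0 ≤ G z := fun z => (Real.exp_pos _).le
  have havg : (2 * t) ^ n * gaussianAverage (ν.map p) y (2 * t) = ∫ z, G z ∂ν := by
    rw [gaussianAverage, integral_map hpm.aemeasurable (by fun_prop), ← mul_assoc, ← mul_pow,
      mul_inv_cancel₀ (by positivity), one_pow, one_mul]
  have hpt : ∀ x ∈ T, b * Real.exp (-Real.pi * ‖y - p x‖ ^ 2 / t ^ 2) ≤
      Real.exp Real.pi * ∫ z in Metric.ball x r, G z ∂ν := by
    intro x hx
    calc _ ≤ ν.real (Metric.ball x r) * Real.exp (-Real.pi * ‖y - p x‖ ^ 2 / t ^ 2) := by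
          gcongr
          exact hb x hx
      _ = ∫ _ in Metric.ball x r, Real.exp (-Real.pi * ‖y - p x‖ ^ 2 / t ^ 2) ∂ν := by
        rw [setIntegral_const, smul_eq_mul]
      _ ≤ ∫ z in Metric.ball x r, Real.exp Real.pi * G z ∂ν := by
        refine setIntegral_mono_on (integrable_const _).integrableOn
          (hGi.const_mul _).integrableOn Metric.isOpen_ball.measurableSet fun z hz => ?_
        rw [hG, ← Real.exp_add, Real.exp_le_exp]
        have h1 : ‖y - p z‖ ≤ ‖y - p x‖ + t := by
          have h2 : dist (p x) (p z) ≤ t := by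
            have := hp.dist_le_mul x z
            rw [NNReal.coe_one, one_mul, dist_comm x z] at this
            have h3 := Metric.mem_ball.1 hz
            have h4 : 0 ≤ dist z x := dist_nonneg
            linarith
          rw [← dist_eq_norm, ← dist_eq_norm]
          linarith [dist_triangle y (p x) (p z)]
        have h5 : ‖y - p z‖ ^ 2 ≤ 4 * ‖y - p x‖ ^ 2 + 4 * t ^ 2 := by
          have : ‖y - p z‖ ^ 2 ≤ (‖y - p x‖ + t) ^ 2 := by gcongr
          nlinarith [sq_nonneg (‖y - p x‖ - t), sq_nonneg (‖y - p x‖), sq_nonneg t]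
        -- Doubling the scale absorbs the displacement by at most `t`, at the cost of the factor
        -- `exp π`.
        have h6 : ‖y - p z‖ ^ 2 / (2 * t) ^ 2 ≤ ‖y - p x‖ ^ 2 / t ^ 2 + 1 := by
          rw [div_add_one (by positivity), div_le_div_iff₀ (by positivity) (by positivity)]
          nlinarith [mul_le_mul_of_nonneg_right h5 (sq_nonneg t)]
        have := mul_le_mul_of_nonneg_left h6 Real.pi_pos.le
        rw [neg_mul, neg_mul, neg_div, neg_div, mul_div_assoc, mul_div_assoc]
        linarith
      _ = _ := integral_const_mul _ _
  have hdisj : (T : Set X).Pairwise (Function.onFun Disjoint fun x => Metric.ball x r) := by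
    intro x hx z hz hxz
    exact Metric.ball_disjoint_ball (by linarith [hT hx hz hxz])
  calc _ ≤ ∑ x ∈ T, Real.exp Real.pi * ∫ z in Metric.ball x r, G z ∂ν := by
        rw [Finset.mul_sum]
        exact Finset.sum_le_sum hpt
    _ = Real.exp Real.pi * ∫ z in ⋃ x ∈ T, Metric.ball x r, G z ∂ν := by
      rw [← Finset.mul_sum, integral_biUnion_finset T
        (fun x _ => Metric.isOpen_ball.measurableSet) hdisj fun x _ => hGi.integrableOn]
    _ ≤ Real.exp Real.pi * ∫ z, G z ∂ν := by
      exact mul_le_mul_of_nonneg_left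
        (setIntegral_le_integral hGi (Filter.Eventually.of_forall hG0)) (Real.exp_pos _).le
    _ = _ := by rw [← havg, mul_assoc]

theorem exists_mul_pow_le_of_le_maximalFunction {μ : Measure (EuclideanSpace ℝ (Fin n))}
    [IsFiniteMeasure μ] {y : EuclideanSpace ℝ (Fin n)} {M M' : ℝ} (hM : M' < M) (hM0 : 0 < M)
    (h : ENNReal.ofReal M ≤ maximalFunction μ y) :
    ∃ r, 0 < r ∧ M' * r ^ n ≤ μ.real (Metric.ball y r) := by
  have h1 : ENNReal.ofReal M' < maximalFunction μ y :=
    ((ENNReal.ofReal_lt_ofReal_iff hM0).2 hM).trans_le h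
  rw [maximalFunction] at h1
  simp only [lt_iSup_iff] at h1
  obtain ⟨r, hr, h1⟩ := h1
  refine ⟨r, hr, ?_⟩
  have h2 : ENNReal.ofReal M' * ENNReal.ofReal r ^ n ≤ μ (Metric.ball y r) := by
    have h0 : ENNReal.ofReal r ^ n ≠ 0 := pow_ne_zero _ (ENNReal.ofReal_pos.2 hr).ne'
    have ht : ENNReal.ofReal r ^ n ≠ ∞ := ENNReal.pow_ne_top ENNReal.ofReal_ne_top
    calc _ ≤ (ENNReal.ofReal r ^ n)⁻¹ * μ (Metric.ball y r) * ENNReal.ofReal r ^ n := by gcongr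
      _ = _ := by rw [mul_right_comm, ENNReal.inv_mul_cancel h0 ht, one_mul]
  rw [← ENNReal.ofReal_pow hr.le, ← ENNReal.ofReal_mul' (by positivity)] at h2
  exact (ENNReal.ofReal_le_iff_le_toReal (measure_ne_top _ _)).1 h2

/-- At a point where the maximal function is at least `M`, there is a dyadic scale at which the
dyadic difference of the Gaussian averages is large, while the Gaussian average at the next larger
scale is at most comparable to `M`. -/
theorem exists_scale_of_le_maximalFunction {m : ℕ} (hm : 0 < m) (hn : n ≠ 0) {c b η q D M : ℝ}
    (hc : c = 2⁻¹ ^ n * Real.exp (-Real.pi) / 2) (hq : 1 / 2 ≤ q) (hq1 : q < 1)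
    (hb : b = c * (1 - q) / (2 ^ m * 4)) (hη : η = b / (2 ^ m * 2)) (hD : 0 < D) (hM : 0 < M)
    {μ : Measure (EuclideanSpace ℝ (Fin n))} [IsFiniteMeasure μ]
    (hμ : μ.real Set.univ ≤ M * (2 * D) ^ n) {y : EuclideanSpace ℝ (Fin n)}
    (hy : ENNReal.ofReal M ≤ maximalFunction μ y) :
    ∃ j : ℕ, b * M * q ^ (j + 1) ≤
        |dyadicDiff (gaussianAverage μ y) m (2 / η * D * 2⁻¹ ^ (j + 1))| ∧
      gaussianAverage μ y (2 / η * D * 2⁻¹ ^ j) ≤ c * M := by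
  have hc0 : 0 < c := by rw [hc]; positivity
  have h2m : (1:ℝ) ≤ 2 ^ m := one_le_pow₀ (by norm_num)
  have hb0 : 0 < b := by
    rw [hb]
    have : 0 < 1 - q := by linarith
    positivity
  have hη0 : 0 < η := by rw [hη]; positivity
  have hc1 : c ≤ 1 / 2 := by
    have h1 : (2⁻¹ : ℝ) ^ n ≤ 1 := pow_le_one₀ (by norm_num) (by norm_num)
    have h2 : Real.exp (-Real.pi) ≤ 1 := Real.exp_le_one_iff.2 (by linarith [Real.pi_pos])
    have := mul_le_one₀ h1 (Real.exp_pos _).le h2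
    rw [hc]; linarith
  have hbc : 2 ^ m * b * (1 - q)⁻¹ = c / 4 := by
    have : 1 - q ≠ 0 := by linarith
    rw [hb]; field_simp
  have hb4 : b ≤ c / 4 := by
    rw [hb, div_le_div_iff₀ (by positivity) (by norm_num)]
    nlinarith [mul_le_mul_of_nonneg_left h2m hc0.le, mul_pos hc0 (by linarith : 0 < q)]
  have hηb : 2 ^ m * η = b / 2 := by rw [hη]; field_simp
  have hη2 : η ≤ b / 2 := by rw [← hηb]; exact le_mul_of_one_le_left hη0.le h2m
  -- Chosen so that `η * t₀ = 2 * D`: the mass bound then reads `M * η ^ n * t₀ ^ n`, and `η ^ n ≤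
  -- η` since `n ≠ 0`.
  set t₀ := 2 / η * D with ht₀
  have ht₀0 : 0 < t₀ := by positivity
  have hηt : η * t₀ = 2 * D := by rw [ht₀]; field_simp
  have hηn : η ^ n ≤ η := pow_le_of_le_one hη0.le (by linarith) hn
  have hmass : ∀ t, t₀ ≤ t → μ.real Set.univ ≤ η * M * t ^ n := by
    intro t ht
    calc _ ≤ M * (2 * D) ^ n := hμ
      _ = M * (η ^ n * t₀ ^ n) := by rw [← hηt, mul_pow]
      _ ≤ M * (η * t ^ n) := by gcongr
      _ = _ := by ring
  have hutop : ∀ t, t₀ ≤ t → |gaussianAverage μ y t| ≤ η * M := by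
    intro t ht
    have ht0 : 0 < t := ht₀0.trans_le ht
    rw [abs_of_nonneg (gaussianAverage_nonneg μ y ht0)]
    calc _ ≤ t⁻¹ ^ n * μ.real Set.univ := gaussianAverage_le μ y ht0
      _ ≤ t⁻¹ ^ n * (η * M * t ^ n) := by gcongr; exact hmass t ht
      _ = _ := by rw [inv_pow]; field_simp
  obtain ⟨r, hr, hrM⟩ := exists_mul_pow_le_of_le_maximalFunction (M' := M / 2) (by linarith) hM hy
  have hrt : r ≤ t₀ := by
    by_contra! hlt
    have h1 := hmass r hlt.le
    have h2 : μ.real (Metric.ball y r) ≤ μ.real Set.univ := measureReal_mono (Set.subset_univ _)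
    have h3 : η * M * r ^ n < M / 2 * r ^ n := by
      gcongr
      nlinarith
    linarith
  obtain ⟨k₁, hk1, hk2⟩ := exists_nat_pow_near_of_lt_one (x := r / t₀) (y := (2⁻¹ : ℝ))
    (by positivity) (by rwa [div_le_one ht₀0]) (by norm_num) (by norm_num)
  rw [lt_div_iff₀ ht₀0] at hk1
  rw [div_le_iff₀ ht₀0] at hk2
  -- The three factors of `c` are spent here: `2⁻¹ ^ n` on rounding `r` to a dyadic scale, `exp
  -- (-π)` on the Gaussian at the edge of the ball, and `1/2` on the supremum not being attained.
  have hex : ∃ k : ℕ, c * M ≤ gaussianAverage μ y (t₀ * 2⁻¹ ^ k) := by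
    refine ⟨k₁, le_trans ?_ (le_gaussianAverage μ y (r := r) (by positivity)
      (by linarith))⟩
    have h1 : 2⁻¹ * (t₀ * 2⁻¹ ^ k₁) ≤ r := by rw [pow_succ] at hk1; linarith
    set t := t₀ * 2⁻¹ ^ k₁
    have htp : 0 < t := by positivity
    calc c * M = t⁻¹ ^ n * (Real.exp (-Real.pi) * (M / 2 * (2⁻¹ * t) ^ n)) := by
          rw [hc, mul_pow, inv_pow t]; field_simp
      _ ≤ t⁻¹ ^ n * (Real.exp (-Real.pi) * (M / 2 * r ^ n)) := by gcongr
      _ ≤ _ := by gcongr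
  classical
  have hk₀ := Nat.find_spec hex
  have hmin : ∀ k, k < Nat.find hex → gaussianAverage μ y (t₀ * 2⁻¹ ^ k) < c * M := fun k hk =>
    not_le.1 (Nat.find_min hex hk)
  obtain ⟨k, hk, hkb⟩ := exists_le_abs_dyadicDiff ht₀0 (m := m) (q := q) (b := b * M) (η := η * M)
    (B := c * M) hq hq1 hutop (by rw [← mul_assoc, hηb]; nlinarith)
    (by
      have : 2 ^ m * (b * M) * (1 - q)⁻¹ = c / 4 * M := by rw [← hbc]; ring
      rw [this]; nlinarith) hm hk₀
  cases k with
  -- At the top scale the difference is at most `2 ^ m * η * M = b * M / 2`, so the selected index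
  -- is positive and a preceding scale exists.
  | zero =>
    exfalso
    have := abs_dyadicDiff_le ht₀0.le hutop m (le_refl t₀)
    rw [← mul_assoc, hηb] at this
    simp only [pow_zero, mul_one] at hkb
    nlinarith [mul_pos hb0 hM]
  | succ j => exact ⟨j, hkb, (hmin j (by omega)).le⟩

end

/-! ### Counting bad points and summing over scales. -/

/-- A separated set at scale `t` on which the dyadic differences of the Gaussian averages are
bounded below has few points. -/
theorem card_le_of_le_dyadicDiff {d n m : ℕ} {A C s σ R c M β t : ℝ} (hσ : 0 ≤ σ) (hA0 : 0 ≤ A)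
    (hA : ∀ x : ℝ,
      dyadicDiff (fun t => Real.exp (-t ^ 2)) m x ^ 2 ≤ A * (x ^ 2) ^ σ * Real.exp (-x ^ 2))
    (hC : 0 < C) (hR : 2 ≤ R) (hc : 0 < c) (hM : 0 < M) (hβ : 0 < β) (ht : 0 < t)
    {ν : Measure (EuclideanSpace ℝ (Fin d))} [IsFiniteMeasure ν]
    {p : EuclideanSpace ℝ (Fin d) → EuclideanSpace ℝ (Fin n)} (hp : LipschitzWith 1 p)
    (hN : sobolevNormSq σ (ν.map p) ≠ ∞) (T : Finset (EuclideanSpace ℝ (Fin d)))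
    (hT : (T : Set (EuclideanSpace ℝ (Fin d))).Pairwise fun x y => t < dist x y)
    (hlow : ∀ x ∈ T, C⁻¹ * (t / R) ^ s ≤ ν.real (Metric.ball x (t / R)))
    (hu : ∀ x ∈ T, gaussianAverage (ν.map p) (p x) (2 * t) ≤ c * M)
    (hw : ∀ x ∈ T, β * M ≤ |dyadicDiff (gaussianAverage (ν.map p) (p x)) m t|) :
    (T.card : ℝ) ≤ A * Real.pi ^ σ * C * R ^ s * Real.exp Real.pi * 2 ^ n * c * β⁻¹ ^ 2 * M⁻¹ *
      t ^ (2 * σ - s) * (sobolevNormSq σ (ν.map p)).toReal := by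
  have hR0 : 0 < R := by linarith
  have hfin : IsFiniteMeasure (ν.map p) := Measure.isFiniteMeasure_map ν p
  -- Row-sum bound: the Gaussian average at scale `2t` divided by the Ahlfors lower bound for the
  -- balls of radius `t / R`, which are disjoint as `R ≥ 2`.
  set B := C * (t / R) ^ (-s) * (Real.exp Real.pi * (2 * t) ^ n * (c * M)) with hB
  have hB0 : 0 < B := by positivity
  have hrow : ∀ x ∈ T, ∑ z ∈ T, Real.exp (-Real.pi * ‖p x - p z‖ ^ 2 / t ^ 2) ≤ B := by
    intro x hx
    have hr : 2 * (t / R) ≤ t := by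
      rw [mul_div_assoc', div_le_iff₀ hR0]; nlinarith
    have h1 := sum_exp_neg_dist_sq_le ν hp T ht hr hT hlow (p x)
    have h2 : Real.exp Real.pi * (2 * t) ^ n * gaussianAverage (ν.map p) (p x) (2 * t) ≤
        Real.exp Real.pi * (2 * t) ^ n * (c * M) := by
      gcongr
      exact hu x hx
    have h3 : C * (t / R) ^ (-s) * (C⁻¹ * (t / R) ^ s) = 1 := by
      rw [Real.rpow_neg (by positivity)]
      field_simp
    calc _ = C * (t / R) ^ (-s) * ((C⁻¹ * (t / R) ^ s) *
          ∑ z ∈ T, Real.exp (-Real.pi * ‖p x - p z‖ ^ 2 / t ^ 2)) := by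
          rw [← mul_assoc, h3, one_mul]
      _ ≤ _ := by
        exact mul_le_mul_of_nonneg_left (h1.trans h2) (by positivity)
  have hsq := sum_sq_dyadicDiff_gaussianAverage_le hσ hA hA0 (ν.map p) hN T p ht hB0 hrow
  have hcard : (T.card : ℝ) * (β * M) ^ 2 ≤
      ∑ x ∈ T, dyadicDiff (gaussianAverage (ν.map p) (p x)) m t ^ 2 := by
    rw [← nsmul_eq_mul, ← Finset.sum_const]
    refine Finset.sum_le_sum fun x hx => ?_
    rw [← sq_abs (dyadicDiff _ _ _)]
    gcongr
    exact hw x hx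
  have h := hcard.trans hsq
  rw [← le_div_iff₀ (by positivity)] at h
  refine h.trans_eq ?_
  rw [hB, Real.rpow_neg (by positivity), Real.div_rpow ht.le hR0.le, Real.rpow_sub ht,
    ← Real.rpow_natCast t 2, ← Real.rpow_mul ht.le, mul_pow 2 t, inv_pow, inv_pow]
  push_cast
  field_simp

theorem exists_hausdorffContent_le (n d : ℕ) (hn : n ≠ 0) (hd : d ≠ 0) {ε C : ℝ} (hε : 0 < ε)
    (hC : 1 ≤ C) :
    ∃ K : NNReal, 1 ≤ K ∧ ∀ s : ℝ, (n : ℝ) < s → s ≤ d → ε < (s - n) / 2 →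
      ∀ ν : Measure (EuclideanSpace ℝ (Fin d)), IsFiniteMeasure ν → IsAhlforsRegular C s ν →
      ∀ D : ℝ, 0 < D → D ≤ 2 → ENNReal.ofReal D = Metric.ediam ν.support →
      ∀ M : ℝ, 0 < M → ν.real Set.univ ≤ M * (2 * D) ^ n →
      ∀ p : EuclideanSpace ℝ (Fin d) → EuclideanSpace ℝ (Fin n), LipschitzWith 1 p →
        sobolevNormSq ((s - n - ε) / 2) (ν.map p) ≠ ∞ →
        hausdorffContent (n + 2 * ε)
            {x ∈ ν.support | ENNReal.ofReal M ≤ maximalFunction (ν.map p) (p x)} ≤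
          K * (ENNReal.ofReal M)⁻¹ * sobolevNormSq ((s - n - ε) / 2) (ν.map p) := by
  obtain ⟨A, hA0, hA⟩ := exists_sq_dyadicDiff_gaussian_le d
  -- `δ ≤ 1` ensures `q ≥ 1/2`, and `δ ≤ ε / 4` ensures that the ratio `θ = 2 ^ (2δ - ε)` of the
  -- final series is below `1`.
  set δ := min (ε / 4) 1 with hδ
  have hδ0 : 0 < δ := lt_min (by positivity) one_pos
  set q := (2 : ℝ) ^ (-δ) with hq
  have hq0 : 0 < q := by positivity
  have hqh : 1 / 2 ≤ q := by
    rw [hq, one_div, ← Real.rpow_neg_one]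
    exact Real.rpow_le_rpow_of_exponent_le (by norm_num) (neg_le_neg (min_le_right _ _))
  have hq1 : q < 1 := Real.rpow_lt_one_of_one_lt_of_neg (by norm_num) (by linarith)
  set θ := q⁻¹ ^ 2 * (2⁻¹ : ℝ) ^ ε with hθ
  have hθ0 : 0 ≤ θ := by positivity
  have hθ1 : θ < 1 := by
    have : θ = (2 : ℝ) ^ (2 * δ - ε) := by
      rw [hθ, hq, Real.rpow_neg (by norm_num), inv_inv, ← Real.rpow_natCast, ← Real.rpow_mul
        (by norm_num), Real.inv_rpow (by norm_num), ← Real.rpow_neg (by norm_num), ← Real.rpow_add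
        (by norm_num)]
      congr 1
      push_cast
      ring
    rw [this]
    refine Real.rpow_lt_one_of_one_lt_of_neg (by norm_num) ?_
    have : δ ≤ ε / 4 := min_le_left _ _
    linarith
  set c := (2⁻¹ : ℝ) ^ n * Real.exp (-Real.pi) / 2 with hc
  set b := c * (1 - q) / (2 ^ d * 4) with hb
  set η := b / (2 ^ d * 2) with hη
  have hc0 : 0 < c := by positivity
  have hb0 : 0 < b := by
    have : 0 < 1 - q := by linarith
    positivity
  have hη0 : 0 < η := by positivity
  set R := 2 / η with hR
  have hη1 : η ≤ 1 := by
    have h1 : (2⁻¹ : ℝ) ^ n ≤ 1 := pow_le_one₀ (by norm_num) (by norm_num)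
    have h2 : Real.exp (-Real.pi) ≤ 1 := Real.exp_le_one_iff.2 (by linarith [Real.pi_pos])
    have h3 := mul_le_one₀ h1 (Real.exp_pos _).le h2
    have h4 : (1:ℝ) ≤ 2 ^ d := one_le_pow₀ (by norm_num)
    have h5 : c ≤ 1 := by rw [hc]; linarith
    have h6 : b ≤ 1 := by
      rw [hb, div_le_one (by positivity)]
      nlinarith
    rw [hη, div_le_one (by positivity)]
    linarith
  have hR2 : 2 ≤ R := by rw [hR, le_div_iff₀ hη0]; linarith
  have hR0 : 0 < R := by linarith
  -- The exponents `σ` and `s` are replaced by their upper bound `d` to make the constant uniform in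
  -- `s`.
  set K₁ := A * Real.pi ^ (d : ℝ) * C * R ^ (d : ℝ) * Real.exp Real.pi * 2 ^ n * c * b⁻¹ ^ 2
    with hK₁
  set K := K₁ * 2 ^ (n + 2 * ε) * (2 * R) ^ ε * (1 - θ)⁻¹ with hK
  have hK₁0 : 0 ≤ K₁ := by positivity
  -- The summand `1` keeps the constant nonzero, so that the final bound is `∞` when the Sobolev
  -- norm is.
  refine ⟨1 + K.toNNReal, by simp, fun s hns hsd hεs ν _ hν D hD0 hD2 hD M hM hmass p hp hN => ?_⟩
  set σ := (s - n - ε) / 2 with hσ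
  have hσ0 : 0 ≤ σ := by rw [hσ]; linarith
  have hσd : σ ≤ d := by
    have : (0 : ℝ) ≤ n := Nat.cast_nonneg n
    rw [hσ]; linarith
  set N := (sobolevNormSq σ (ν.map p)).toReal with hNdef
  have hN0 : 0 ≤ N := ENNReal.toReal_nonneg
  have hfin : IsFiniteMeasure (ν.map p) := Measure.isFiniteMeasure_map ν p
  have hpm : Measurable p := hp.continuous.measurable
  -- Starting at exponent `j + 1` makes `2 * t j` the preceding scale and `t j / R ≤ D`, where the
  -- Ahlfors lower bound is available.
  set t : ℕ → ℝ := fun j => R * D * 2⁻¹ ^ (j + 1) with ht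
  have ht0 : ∀ j, 0 < t j := fun j => by positivity
  have htD : ∀ j, t j / R ≤ D := by
    intro j
    rw [ht, div_le_iff₀ hR0, mul_comm D R]
    exact mul_le_of_le_one_right (by positivity) (pow_le_one₀ (by norm_num) (by norm_num))
  set X : ℕ → Set (EuclideanSpace ℝ (Fin d)) := fun j => {x ∈ ν.support |
    b * M * q ^ (j + 1) ≤ |dyadicDiff (gaussianAverage (ν.map p) (p x)) d (t j)| ∧
    gaussianAverage (ν.map p) (p x) (2 * t j) ≤ c * M} with hX
  have hcov : ∀ j, ∃ T : Finset (EuclideanSpace ℝ (Fin d)),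
      (T.card : ℝ) ≤ K₁ * q⁻¹ ^ (2 * (j + 1)) * M⁻¹ * t j ^ (2 * σ - s) * N ∧
      X j ⊆ ⋃ x ∈ T, Metric.closedBall x (t j) := by
    intro j
    refine exists_finset_cover_of_card_le (X j) (ht0 j).le fun T hTX hT => ?_
    have h := card_le_of_le_dyadicDiff (s := s) (C := C) (R := R) (c := c) (M := M)
      (β := b * q ^ (j + 1)) hσ0 hA0.le
      (hA σ hσ0 (by linarith [(Nat.cast_nonneg d : (0:ℝ) ≤ d)])) (by linarith) hR2 hc0 hM
      (by positivity) (ht0 j) hp hN T hT (fun x hx => ?_) (fun x hx => (hTX hx).2.2)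
      (fun x hx => ?_)
    · refine h.trans ?_
      rw [hK₁, mul_inv, mul_pow, ← inv_pow, ← pow_mul, mul_comm (j + 1) 2, ← mul_assoc]
      have hpi : Real.pi ^ σ ≤ Real.pi ^ (d : ℝ) :=
        Real.rpow_le_rpow_of_exponent_le (by linarith [Real.pi_gt_three]) hσd
      have hRs : R ^ s ≤ R ^ (d : ℝ) := Real.rpow_le_rpow_of_exponent_le (by linarith) hsd
      have := ht0 j
      gcongr
    · have := hν.lower x (hTX hx).1 (t j / R) (div_pos (ht0 j) hR0)
        (by rw [← hD]; exact ENNReal.ofReal_le_ofReal (htD j))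
      exact (ENNReal.ofReal_le_iff_le_toReal (measure_ne_top _ _)).1 this
    · have := (hTX hx).2.1
      rwa [mul_right_comm] at this
  choose T hTcard hTcov using hcov
  have hsub : {x ∈ ν.support | ENNReal.ofReal M ≤ maximalFunction (ν.map p) (p x)} ⊆
      ⋃ j, ⋃ x ∈ T j, Metric.closedBall x (t j) := by
    rintro x ⟨hx, hxM⟩
    obtain ⟨j, h1, h2⟩ := exists_scale_of_le_maximalFunction (m := d) (Nat.pos_of_ne_zero hd) hn
      hc hqh hq1 hb hη hD0 hM
      (by rwa [measureReal_def, Measure.map_apply hpm MeasurableSet.univ, Set.preimage_univ]) hxM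
    refine Set.mem_iUnion.2 ⟨j, hTcov j ⟨hx, h1, ?_⟩⟩
    have : 2 * t j = 2 / η * D * 2⁻¹ ^ j := by simp only [ht, hR, pow_succ]; ring
    rwa [this]
  have hterm : ∀ j, ((T j).card : ℝ) * (2 * t j) ^ (n + 2 * ε) ≤
      (K₁ * 2 ^ (n + 2 * ε) * (2 * R) ^ ε * M⁻¹ * N) * θ ^ j := by
    intro j
    have htj := ht0 j
    have e1 : t j ^ (2 * σ - s) * t j ^ (n + 2 * ε) = t j ^ ε := by
      rw [← Real.rpow_add htj]
      congr 1
      rw [hσ]; ring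
    have e2 : t j ^ ε ≤ (2 * R) ^ ε * ((2⁻¹ : ℝ) ^ ε) ^ (j + 1) := by
      rw [← Real.rpow_natCast ((2⁻¹ : ℝ) ^ ε), ← Real.rpow_mul (by norm_num), mul_comm ε,
        Real.rpow_mul (by norm_num), Real.rpow_natCast, ← Real.mul_rpow (by positivity)
        (by positivity)]
      refine Real.rpow_le_rpow htj.le ?_ hε.le
      rw [mul_comm 2 R]
      exact mul_le_mul_of_nonneg_right (by gcongr) (by positivity)
    calc _ ≤ (K₁ * q⁻¹ ^ (2 * (j + 1)) * M⁻¹ * t j ^ (2 * σ - s) * N) *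
          (2 ^ (n + 2 * ε) * t j ^ (n + 2 * ε)) := by
          rw [Real.mul_rpow (by norm_num) htj.le]
          gcongr
          exact hTcard j
      _ = (K₁ * q⁻¹ ^ (2 * (j + 1)) * M⁻¹ * N * 2 ^ (n + 2 * ε)) * t j ^ ε := by rw [← e1]; ring
      _ ≤ (K₁ * q⁻¹ ^ (2 * (j + 1)) * M⁻¹ * N * 2 ^ (n + 2 * ε)) *
          ((2 * R) ^ ε * ((2⁻¹ : ℝ) ^ ε) ^ (j + 1)) := by gcongr
      _ = (K₁ * 2 ^ (n + 2 * ε) * (2 * R) ^ ε * M⁻¹ * N) * θ ^ (j + 1) := by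
        rw [hθ, mul_pow, ← pow_mul]; ring
      _ ≤ _ := by
        gcongr ?_ * ?_
        exact pow_le_pow_of_le_one hθ0 hθ1.le (by omega)
  have hsum : Summable fun j => (K₁ * 2 ^ (n + 2 * ε) * (2 * R) ^ ε * M⁻¹ * N) * θ ^ j :=
    (summable_geometric_of_lt_one hθ0 hθ1).mul_left _
  calc _ ≤ ∑' j, ENNReal.ofReal ((T j).card * (2 * t j) ^ (n + 2 * ε)) :=
        hausdorffContent_le_tsum_card (by positivity) T t (fun j => (ht0 j).le) hsub
    _ ≤ ∑' j, ENNReal.ofReal ((K₁ * 2 ^ (n + 2 * ε) * (2 * R) ^ ε * M⁻¹ * N) * θ ^ j) :=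
        ENNReal.tsum_le_tsum fun j => ENNReal.ofReal_le_ofReal (hterm j)
    _ = ENNReal.ofReal (K * M⁻¹ * N) := by
        rw [← ENNReal.ofReal_tsum_of_nonneg (fun j => by positivity) hsum, tsum_mul_left,
          tsum_geometric_of_lt_one hθ0 hθ1, hK]
        congr 1
        ring
    _ ≤ _ := by
        have hK0 : 0 ≤ K := mul_nonneg (by positivity) (inv_nonneg.2 (by linarith))
        rw [ENNReal.ofReal_mul (by positivity), ENNReal.ofReal_mul hK0,
          ENNReal.ofReal_inv_of_pos hM, hNdef, ENNReal.ofReal_toReal hN]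
        gcongr
        rw [ENNReal.ofReal, ENNReal.coe_le_coe]
        exact le_add_self

/-! ### Reduction of the theorem to the case of controlled total mass. -/

theorem lipschitzWith_projTo {d n : ℕ} (L : Submodule ℝ (EuclideanSpace ℝ (Fin d)))
    (e : L ≃ₗᵢ[ℝ] EuclideanSpace ℝ (Fin n)) : LipschitzWith 1 (projTo L e) := by
  refine LipschitzWith.mk_one fun x y => ?_
  rw [projTo, projTo, e.dist_map, dist_eq_norm, ← map_sub, dist_eq_norm]
  exact L.norm_orthogonalProjectionOnto_apply_le _

theorem measure_univ_eq_measure_support {d : ℕ} (ν : Measure (EuclideanSpace ℝ (Fin d))) :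
    ν Set.univ = ν ν.support := by
  rw [← measure_add_measure_compl Measure.isClosed_support.measurableSet,
    Measure.measure_compl_support, add_zero]

/-- The ball of radius `2 * D` about `p x` contains the whole image of the support, so the maximal
function has this floor on all of `F`. -/
theorem le_maximalFunction_map_of_mem_support {d n : ℕ}
    {ν : Measure (EuclideanSpace ℝ (Fin d))} [IsFiniteMeasure ν]
    {p : EuclideanSpace ℝ (Fin d) → EuclideanSpace ℝ (Fin n)} (hp : LipschitzWith 1 p) {D : ℝ}
    (hD0 : 0 < D) (hD : Metric.ediam ν.support ≤ ENNReal.ofReal D)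
    {x : EuclideanSpace ℝ (Fin d)} (hx : x ∈ ν.support) :
    ENNReal.ofReal (ν.real Set.univ / (2 * D) ^ n) ≤ maximalFunction (ν.map p) (p x) := by
  have h2D : 0 < 2 * D := by positivity
  refine le_trans ?_ (le_iSup₂_of_le (2 * D) h2D le_rfl)
  rw [Measure.map_apply hp.continuous.measurable Metric.isOpen_ball.measurableSet, div_eq_inv_mul,
    ENNReal.ofReal_mul (by positivity), ENNReal.ofReal_inv_of_pos (by positivity),
    ENNReal.ofReal_pow h2D.le, ofReal_measureReal]
  refine mul_le_mul_right ?_ _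
  rw [measure_univ_eq_measure_support]
  refine measure_mono fun z hz => ?_
  rw [Set.mem_preimage, Metric.mem_ball]
  have h2 : edist z x ≤ ENNReal.ofReal D := (Metric.edist_le_ediam_of_mem hz hx).trans hD
  rw [edist_dist, ENNReal.ofReal_le_ofReal_iff hD0.le] at h2
  have h3 := hp.dist_le_mul z x
  rw [NNReal.coe_one, one_mul] at h3
  linarith

/-- The constant `K` depends only on `d`, `ε` and the Ahlfors regularity constant `C`. -/
theorem proposition3p1 (d : ℕ) (ε C : ℝ) (hε : 0 < ε) (hC : 1 ≤ C) :
    ∃ K : NNReal, ∀ (n : ℕ) (s : ℝ), (n : ℝ) < s → s ≤ min (2 * (n : ℝ)) (d : ℝ) →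
      ε < (s - n) / 2 →
      ∀ ν : Measure (EuclideanSpace ℝ (Fin d)), IsAhlforsRegular C s ν →
        ν.support ⊆ Metric.ball 0 1 →
      ∀ M : ℝ, 3 ^ n * ν ν.support < ENNReal.ofReal M →
      ∀ L : Submodule ℝ (EuclideanSpace ℝ (Fin d)), Module.finrank ℝ L = n →
      ∀ e : L ≃ₗᵢ[ℝ] EuclideanSpace ℝ (Fin n),
        hausdorffContent (n + 2 * ε)
            {x ∈ ν.support |
              ENNReal.ofReal M ≤ maximalFunction (projMeasure L e ν) (projTo L e x)} ≤
          K * (ENNReal.ofReal M)⁻¹ * sobolevNormSq ((s - n - ε) / 2) (projMeasure L e ν) := by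
  have hex : ∀ n : ℕ, n ≠ 0 → d ≠ 0 → _ := fun n hn hd =>
    exists_hausdorffContent_le n d hn hd hε hC
  choose! K hK1 hK using hex
  -- Only `n < d` can occur, so summing over these values removes the dependence on `n`.
  refine ⟨∑ n ∈ Finset.range d, K n, fun n s hns hs hεs ν hν hsupp M hM L _ e => ?_⟩
  have hs2 := hs.trans (min_le_left _ _)
  have hsd := hs.trans (min_le_right _ _)
  have hn : n ≠ 0 := by
    rintro rfl
    simp only [Nat.cast_zero, mul_zero] at hns hs2
    linarith
  have hnd : n < d := by exact_mod_cast hns.trans_le hsd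
  have hd : d ≠ 0 := by omega
  have hKn : K n ≤ ∑ n ∈ Finset.range d, K n :=
    Finset.single_le_sum (f := K) (fun _ _ => zero_le) (Finset.mem_range.2 hnd)
  have hM0 : 0 < M := ENNReal.ofReal_pos.1 (zero_le.trans_lt hM)
  have hfin : IsFiniteMeasure ν := by
    refine ⟨?_⟩
    rw [measure_univ_eq_measure_support]
    refine lt_of_le_of_lt ?_ (hM.trans ENNReal.ofReal_lt_top)
    exact le_mul_of_one_le_left' (one_le_pow₀ (by norm_num))
  have hp := lipschitzWith_projTo L e
  rw [projMeasure]
  set p := projTo L e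
  by_cases hN : sobolevNormSq ((s - n - ε) / 2) (ν.map p) = ∞
  · rw [hN, ENNReal.mul_top]
    · exact le_top
    · refine mul_ne_zero ?_ (ENNReal.inv_ne_zero.2 ENNReal.ofReal_ne_top)
      rw [ENNReal.coe_ne_zero]
      exact (one_pos.trans_le ((hK1 n hn hd).trans hKn)).ne'
  rcases ν.support.subsingleton_or_nontrivial with hF | hF
  · rw [hausdorffContent_subsingleton (by positivity) (hF.anti (Set.sep_subset _ _))]
    exact zero_le
  have hbdd : Bornology.IsBounded ν.support := Metric.isBounded_ball.subset hsupp
  set D := Metric.diam ν.support with hDdef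
  have hD0 : 0 < D := Metric.diam_pos hF hbdd
  have hD2 : D ≤ 2 := by
    calc D ≤ Metric.diam (Metric.ball (0 : EuclideanSpace ℝ (Fin d)) 1) :=
          Metric.diam_mono hsupp Metric.isBounded_ball
      _ ≤ 2 * 1 := Metric.diam_ball zero_le_one
      _ = 2 := mul_one 2
  have hDe : ENNReal.ofReal D = Metric.ediam ν.support :=
    ENNReal.ofReal_toReal hbdd.ediam_ne_top
  -- If `D` is small, the mass may exceed `M * (2 * D) ^ n`. Raising `M` to `M'` restores the bound
  -- without shrinking `F_M`, because the maximal function is at least `ν.real Set.univ / (2 * D) ^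
  -- n` on `F`; and `M'⁻¹ ≤ M⁻¹`.
  set M' := max M (ν.real Set.univ / (2 * D) ^ n) with hM'
  have hMM' : M ≤ M' := le_max_left _ _
  have hmain := hK n hn hd s hns hsd hεs ν hfin hν D hD0 hD2 hDe M' (hM0.trans_le hMM')
    (by rw [← div_le_iff₀ (by positivity)]; exact le_max_right _ _) p hp hN
  refine (hausdorffContent_mono _ ?_).trans (hmain.trans ?_)
  · rintro x ⟨hx, hxM⟩
    refine ⟨hx, ?_⟩
    rw [hM', ENNReal.ofReal_max]
    exact max_le hxM (le_maximalFunction_map_of_mem_support hp hD0 hDe.ge hx)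
  · gcongr
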